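/- Let $d\ge 2$, let $d\sigma$ be the surface measure on the unit sphere $\mathbb S^{d-1}\subset\mathbb R^d$, let $k\in\mathbb S^{d-1}$, and let $\beta:[-1,1]\to\mathbb R_+$ be a measurable function with $\int_{\mathbb S^{d-1}}(1-k\cdot\sigma)\,\beta(k\cdot\sigma)\,d\sigma<\infty$ (by rotation invariance, integrals of functions of $k\cdot\sigma$ do not depend on $k$). Set $$\Gamma_\beta(g)(x)=\frac12\int_{\mathbb S^{d-1}}\bigl(g(\sigma)-g(x)\bigr)^2\beta(x\cdot\sigma)\,d\sigma,\qquad \Sigma(\beta)=\frac1{2(d-1)}\int_{\mathbb S^{d-1}}\bigl[1-(k\cdot\sigma)^2\bigr]\beta(k\cdot\sigma)\,d\sigma .$$ (a) For every even function $g$ on $\mathbb S^{d-1}$ in the Sobolev space $H^1(\mathbb S^{d-1})$, with weak gradient $\nabla g$, $$\int_{\mathbb S^{d-1}}\Gamma_\beta(g)\,dx\le \Sigma(\beta)\int_{\mathbb S^{d-1}}|\nabla g|^2\,dx,$$ and $\Sigma(\beta)$ is the smallest constant in $[0,\infty]$ for which this inequality holds for all such $g$. For each $n$ with $1\le n\le\infty$,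 the inequality likewise holds for all even functions $g$ of class $C^n$ on $\mathbb S^{d-1}$, with their usual gradient on the sphere, and $\Sigma(\beta)$ is the smallest constant for which it holds for all of these. (b) Let $P_\ell=P_\ell^{(d)}$ be the Legendre polynomials in dimension $d$, that is, $P_0(x)=1$, $P_1(x)=x$ and $(\ell+d-2)P_{\ell+1}(x)-(2\ell+d-2)\,x\,P_\ell(x)+\ell P_{\ell-1}(x)=0$ for $\ell\ge1$. Then for every even integer $\ell\ge 0$, $$\frac{1-P_\ell(x)}{1-x^2}\le\frac{\ell(\ell+d-2)}{2(d-1)}\qquad\text{for all }x\in(-1,1),$$ with equality for all $x\in(-1,1)$ if $\ell=2$; and for every even $\ell$ the left-hand side converges to the right-hand side as $x\to1^-$ and as $x\to-1^+$. -/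

import Mathlib

open MeasureTheory Filter Topology Set
open scoped ENNReal RealInnerProductSpace ContDiff

noncomputable section

/-- The Euclidean space `ℝᵈ`. -/
abbrev Euc (d : ℕ) : Type := EuclideanSpace ℝ (Fin d)

/-- The unit sphere `𝕊^{d-1}` of `ℝᵈ`. -/
abbrev Sph (d : ℕ) : Type := Metric.sphere (0 : Euc d) 1

/-- The (unnormalised) surface measure `dσ` on `𝕊^{d-1}`, whose total mass is `|𝕊^{d-1}|`. -/
def surf (d : ℕ) : Measure (Sph d) := (volume : Measure (Euc d)).toSphere

/-- The scalar product `k · σ` of two points of the sphere. -/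
def sdot {d : ℕ} (k σ : Sph d) : ℝ := ⟪(k : Euc d), (σ : Euc d)⟫

/-- `β` is an angular collision kernel on `𝕊^{d-1}`: a measurable function, nonnegative on
`[-1, 1]`, with `∫ (1 - k·σ) β(k·σ) dσ < ∞`, where `k` is a fixed unit vector. -/
structure IsCollisionKernel {d : ℕ} (β : ℝ → ℝ) (k : Sph d) : Prop where
  measurable : Measurable β
  nonneg : ∀ x ∈ Icc (-1 : ℝ) 1, 0 ≤ β x
  integrable : Integrable (fun σ : Sph d => (1 - sdot k σ) * β (sdot k σ)) (surf d)

/-- `Γ_β(g)(k) = ½ ∫ (g(σ) - g(k))² β(k·σ) dσ`, as an element of `[0, ∞]`. -/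
def gammaBeta {d : ℕ} (β : ℝ → ℝ) (g : Sph d → ℝ) (k : Sph d) : ℝ≥0∞ :=
  2⁻¹ * ∫⁻ σ, ENNReal.ofReal ((g σ - g k) ^ 2 * β (sdot k σ)) ∂(surf d)

/-- `Σ(β) = (1 / (2(d-1))) ∫ (1 - (k·σ)²) β(k·σ) dσ`, where `k` is a fixed unit vector. -/
def sigmaBeta {d : ℕ} (β : ℝ → ℝ) (k : Sph d) : ℝ :=
  1 / (2 * ((d : ℝ) - 1)) * ∫ σ, (1 - sdot k σ ^ 2) * β (sdot k σ) ∂(surf d)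

/-- The `0`-homogeneous extension `x ↦ g(x/|x|)` of a function on the sphere
(with the irrelevant value `0` at the origin). -/
def radialExt {d : ℕ} (g : Sph d → ℝ) (x : Euc d) : ℝ :=
  if h : x = 0 then 0
  else g ⟨‖x‖⁻¹ • x, by
    rw [mem_sphere_zero_iff_norm, norm_smul, norm_inv, norm_norm,
      inv_mul_cancel₀ (norm_ne_zero_iff.mpr h)]⟩

/-- `g` is of class `Cⁿ` on the sphere: its `0`-homogeneous extension is `Cⁿ` off the origin. -/
def SphContDiff {d : ℕ} (n : ℕ∞) (g : Sph d → ℝ) : Prop :=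
  ContDiffOn ℝ n (radialExt g) {0}ᶜ

/-- The gradient of `g` on the sphere: the usual gradient in `ℝᵈ` of the `0`-homogeneous
extension. -/
def sphGrad {d : ℕ} (g : Sph d → ℝ) (σ : Sph d) : Euc d :=
  gradient (radialExt g) (σ : Euc d)

/-- The divergence on the sphere, at `σ`, of a vector field `X` defined on `ℝᵈ` and tangent to
the sphere: the trace of `DX(σ)` over the tangent space `σ^⊥`. -/
def sphDiv {d : ℕ} (X : Euc d → Euc d) (σ : Sph d) : ℝ :=
  LinearMap.trace ℝ (Euc d) (fderiv ℝ X (σ : Euc d) : Euc d →ₗ[ℝ] Euc d)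
    - ⟪fderiv ℝ X (σ : Euc d) (σ : Euc d), (σ : Euc d)⟫

/-- `g` belongs to the Sobolev space `H¹(𝕊^{d-1})`, with weak gradient `G`: `g` and the tangent
vector field `G` are square integrable, and `∫ G · X dσ = - ∫ g div X dσ` for every smooth
tangent vector field `X`. -/
structure HasWeakGrad {d : ℕ} (g : Sph d → ℝ) (G : Sph d → Euc d) : Prop where
  memLp : MemLp g 2 (surf d)
  memLp_grad : MemLp G 2 (surf d)
  tangent : ∀ᵐ σ ∂(surf d), ⟪G σ, (σ : Euc d)⟫ = 0
  integral_eq : ∀ X : Euc d → Euc d, ContDiff ℝ ∞ X →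
    (∀ σ : Sph d, ⟪X (σ : Euc d), (σ : Euc d)⟫ = 0) →
    ∫ σ, ⟪G σ, X (σ : Euc d)⟫ ∂(surf d) = - ∫ σ, g σ * sphDiv X σ ∂(surf d)

/-- The Legendre polynomials `P_ℓ^{(d)}` in dimension `d ≥ 2`, normalised by `P_ℓ(1) = 1`:
`P₀ = 1`, `P₁ = x`, and `(ℓ+d-2) P_{ℓ+1} - (2ℓ+d-2) x P_ℓ + ℓ P_{ℓ-1} = 0` for `ℓ ≥ 1`
(here with `ℓ = m + 1`). -/
def legendreP (d : ℕ) : ℕ → Polynomial ℝ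
  | 0 => 1
  | 1 => Polynomial.X
  | m + 2 =>
    Polynomial.C ((2 * ((m : ℝ) + 1) + d - 2) / (((m : ℝ) + 1) + d - 2)) * Polynomial.X
        * legendreP d (m + 1)
      - Polynomial.C (((m : ℝ) + 1) / (((m : ℝ) + 1) + d - 2)) * legendreP d m

end

/-! Both halves rest on one elementary estimate, `sin² (n t) ≤ n² sin² t` for integers `n`; evenness
is what ensures that only doubled frequencies `2n` occur, for which `1 - cos (2 n t) = 2 sin² (n
t)`.

For part (a) with `g` of class `C¹`, average the double integral over rotations. For `x`, `σ` at
angle `t`, the mean over `R` of `(g (R σ) - g (R x))²` depends only on `t`, so it can also be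
averaged over all positions of an arc of length `t` on a great circle. Along a great circle an even
`g` is a `π`-periodic function `u`, and Parseval gives `∫ (u (s + t) - u s)² ≤ sin² t ∫ u'²`
(`integral_sq_translate_sub_le`, `lintegral_orth_sq_sub_le`). A directional derivative carries on
average the fraction `1/(d-1)` of the squared gradient (`lintegral_orth_norm_gradient_sq`).
Integrating `sin² t = 1 - (x·σ)²` against `β` then yields exactly `Σ(β)`.

The constant is attained by `⟪p, x⟫ ⟪q, x⟫` with `p`, `q` orthonormal: by polarization its increment
from `x` to `σ` is `sin t` times its derivative at the midpoint of the arc, so equality holds for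
each angle (`lintegral_gammaBeta_inner_mul_inner`).

To reach `H¹`, convolve with polynomial zonal densities peaking at `x·σ = 1`. The convolutions are
`C¹` and even, their gradient energy does not exceed that of the weak gradient
(`norm_sphGrad_zonalConv_sq_le`), and a subsequence converges almost everywhere, so Fatou's lemma
concludes.

For part (b), the generating function `(1 - r e^{it})^{-λ} (1 - r e^{-it})^{-λ}` with `λ = (d-2)/2`
writes `P_ℓ (cos t)` as a convex combination of cosines `cos (n t)` with `n` of the parity of `ℓ`
(`eval_cos_legendreP_eq_sum`). The estimate applies term by term, and the weighted sum of the `n²`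
is `P_ℓ' (1)`. -/

/-! ### Legendre polynomials: recurrence, parity and values at the endpoint -/

theorem legendreP_add_two (d m : ℕ) :
    legendreP d (m + 2) =
      Polynomial.C ((2 * ((m : ℝ) + 1) + d - 2) / (((m : ℝ) + 1) + d - 2)) * Polynomial.X
        * legendreP d (m + 1)
      - Polynomial.C (((m : ℝ) + 1) / (((m : ℝ) + 1) + d - 2)) * legendreP d m := by
  rw [legendreP]

theorem eval_legendreP_add_two {d : ℕ} (hd : 2 ≤ d) (m : ℕ) (x : ℝ) :
    ((m : ℝ) + 1 + d - 2) * (legendreP d (m + 2)).eval x =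
      (2 * ((m : ℝ) + 1) + d - 2) * x * (legendreP d (m + 1)).eval x
        - ((m : ℝ) + 1) * (legendreP d m).eval x := by
  have h2 : (2 : ℝ) ≤ d := by exact_mod_cast hd
  have h0 : (m : ℝ) + 1 + d - 2 ≠ 0 := by have : (0 : ℝ) ≤ m := m.cast_nonneg; linarith
  rw [legendreP_add_two]
  simp only [Polynomial.eval_sub, Polynomial.eval_mul, Polynomial.eval_C, Polynomial.eval_X]
  field_simp

theorem eval_one_legendreP {d : ℕ} (hd : 2 ≤ d) (ℓ : ℕ) : (legendreP d ℓ).eval 1 = 1 := by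
  induction ℓ using Nat.strong_induction_on with
  | _ ℓ ih =>
    match ℓ with
    | 0 => simp [legendreP]
    | 1 => simp [legendreP]
    | m + 2 =>
      have h2 : (2 : ℝ) ≤ d := by exact_mod_cast hd
      have h0 : (m : ℝ) + 1 + d - 2 ≠ 0 := by have : (0 : ℝ) ≤ m := m.cast_nonneg; linarith
      have h := eval_legendreP_add_two hd m 1
      rw [ih (m + 1) (by omega), ih m (by omega)] at h
      apply mul_left_cancel₀ h0
      rw [h]; ring

theorem eval_neg_legendreP {d : ℕ} (hd : 2 ≤ d) (ℓ : ℕ) (x : ℝ) :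
    (legendreP d ℓ).eval (-x) = (-1) ^ ℓ * (legendreP d ℓ).eval x := by
  induction ℓ using Nat.strong_induction_on with
  | _ ℓ ih =>
    match ℓ with
    | 0 => simp [legendreP]
    | 1 => simp [legendreP]
    | m + 2 =>
      have h2 : (2 : ℝ) ≤ d := by exact_mod_cast hd
      have h0 : (m : ℝ) + 1 + d - 2 ≠ 0 := by have : (0 : ℝ) ≤ m := m.cast_nonneg; linarith
      have h := eval_legendreP_add_two hd m (-x)
      rw [ih (m + 1) (by omega), ih m (by omega)] at h
      apply mul_left_cancel₀ h0
      rw [h]; linear_combination -(-1) ^ m * eval_legendreP_add_two hd m x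

/-- This is twice the constant of part (b), and by the chain rule also minus the second derivative
of `t ↦ P_ℓ (cos t)` at `0`. -/
theorem eval_one_derivative_legendreP {d : ℕ} (hd : 2 ≤ d) (ℓ : ℕ) :
    (legendreP d ℓ).derivative.eval 1 = ℓ * (ℓ + d - 2) / ((d : ℝ) - 1) := by
  have h2 : (2 : ℝ) ≤ d := by exact_mod_cast hd
  have h1 : (d : ℝ) - 1 ≠ 0 := by linarith
  induction ℓ using Nat.strong_induction_on with
  | _ ℓ ih =>
    match ℓ with
    | 0 => simp [legendreP]
    | 1 => simp [legendreP]; field_simp; ring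
    | m + 2 =>
      have h0 : (m : ℝ) + 1 + d - 2 ≠ 0 := by have : (0 : ℝ) ≤ m := m.cast_nonneg; linarith
      rw [legendreP_add_two]
      simp only [Polynomial.derivative_sub, Polynomial.derivative_mul, Polynomial.derivative_C,
        Polynomial.derivative_X, Polynomial.eval_sub, Polynomial.eval_mul, Polynomial.eval_add,
        Polynomial.eval_C, Polynomial.eval_X, Polynomial.eval_zero, Polynomial.eval_one,
        ih (m + 1) (by omega), ih m (by omega), eval_one_legendreP hd]
      push_cast
      field_simp
      ring

/-! ### Cosine expansion with nonnegative coefficients -/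

/-- The coefficients of `(1 - r)^{-λ}`. -/
noncomputable def negBinomCoeff (lam : ℝ) : ℕ → ℝ
  | 0 => 1
  | k + 1 => (lam + k) / (k + 1) * negBinomCoeff lam k

theorem negBinomCoeff_succ (lam : ℝ) (k : ℕ) :
    ((k : ℝ) + 1) * negBinomCoeff lam (k + 1) = (lam + k) * negBinomCoeff lam k := by
  rw [negBinomCoeff]; field_simp

theorem negBinomCoeff_pos {lam : ℝ} (h : 0 < lam) (k : ℕ) : 0 < negBinomCoeff lam k := by
  induction k with
  | zero => simp [negBinomCoeff]
  | succ k ih => rw [negBinomCoeff]; positivity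

/-- The power series `(1 - zr)^{-λ}` in `r`. -/
noncomputable def negBinomSeries (lam : ℝ) (z : ℂ) : PowerSeries ℂ :=
  PowerSeries.mk fun k => (negBinomCoeff lam k : ℂ) * z ^ k

/-- A first-order equation survives multiplication: the product rule combines those for `z` and `w`
without expanding a Cauchy product. -/
theorem negBinomSeries_ode (lam : ℝ) (z : ℂ) :
    (1 - PowerSeries.C z * PowerSeries.X) * (PowerSeries.derivative ℂ (negBinomSeries lam z)) =
      PowerSeries.C ((lam : ℂ) * z) * negBinomSeries lam z := by
  ext n
  rw [sub_mul, one_mul, map_sub, mul_assoc, PowerSeries.coeff_C_mul, PowerSeries.coeff_C_mul,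
    PowerSeries.coeff_derivative, negBinomSeries, PowerSeries.coeff_mk, PowerSeries.coeff_mk]
  have key : ((n : ℂ) + 1) * (negBinomCoeff lam (n + 1) : ℂ) =
      ((lam : ℂ) + n) * (negBinomCoeff lam n : ℂ) := by
    exact_mod_cast negBinomCoeff_succ lam n
  cases n with
  | zero => 
    simp only [PowerSeries.coeff_zero_X_mul]
    push_cast at key ⊢
    linear_combination z * key
  | succ n =>
    rw [PowerSeries.coeff_succ_X_mul, PowerSeries.coeff_derivative, PowerSeries.coeff_mk]
    push_cast at key ⊢
    linear_combination z ^ (n + 2) * key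

/-- For `zw = 1` the product `F` satisfies `(1 - (z+w) r + r²) F' = λ (z + w - 2r) F`; its
coefficients therefore obey the Gegenbauer recurrence, a rescaling of that of `legendreP`. -/
theorem coeff_negBinomSeries_mul_recurrence (lam : ℝ) {z w : ℂ} (hzw : z * w = 1) (n : ℕ) :
    ((n : ℂ) + 2) * PowerSeries.coeff (n + 2) (negBinomSeries lam z * negBinomSeries lam w) =
      (z + w) * (n + 1 + lam) *
          PowerSeries.coeff (n + 1) (negBinomSeries lam z * negBinomSeries lam w)
        - (n + 2 * lam) * PowerSeries.coeff n (negBinomSeries lam z * negBinomSeries lam w) := by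
  have hz := negBinomSeries_ode lam z
  have hw := negBinomSeries_ode lam w
  set A := negBinomSeries lam z
  set B := negBinomSeries lam w
  set F := A * B with hF
  have hC : (PowerSeries.C z : PowerSeries ℂ) * PowerSeries.C w = 1 := by
    rw [← map_mul, hzw, map_one]
  have hode : (1 - PowerSeries.C (z + w) * PowerSeries.X + PowerSeries.X ^ 2) *
      PowerSeries.derivative ℂ F =
      (PowerSeries.C ((lam : ℂ) * (z + w)) - PowerSeries.C (2 * (lam : ℂ)) * PowerSeries.X) * F := by
    have hd : PowerSeries.derivative ℂ F =
        A * PowerSeries.derivative ℂ B + B * PowerSeries.derivative ℂ A := by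
      rw [hF, Derivation.leibniz, smul_eq_mul, smul_eq_mul]
    rw [hd, hF]
    simp only [map_mul, map_add] at hz hw ⊢
    rw [map_ofNat]
    linear_combination (1 - PowerSeries.C w * PowerSeries.X) * B * hz
      + (1 - PowerSeries.C z * PowerSeries.X) * A * hw
      - (PowerSeries.X ^ 2 * (A * PowerSeries.derivative ℂ B + B * PowerSeries.derivative ℂ A)
        + 2 * PowerSeries.C (lam : ℂ) * PowerSeries.X * A * B) * hC
  have hc := congrArg (PowerSeries.coeff (n + 1)) hode
  rw [add_mul, sub_mul, sub_mul, one_mul, map_add, map_sub, map_sub, mul_assoc, mul_assoc,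
    PowerSeries.coeff_C_mul, PowerSeries.coeff_C_mul, PowerSeries.coeff_C_mul, pow_two, mul_assoc,
    PowerSeries.coeff_succ_X_mul, PowerSeries.coeff_succ_X_mul, PowerSeries.coeff_succ_X_mul,
    PowerSeries.coeff_derivative, PowerSeries.coeff_derivative] at hc
  have hx : PowerSeries.coeff n (PowerSeries.X * PowerSeries.derivative ℂ F) =
      n * PowerSeries.coeff n F := by
    cases n with
    | zero => simp
    | succ n => rw [PowerSeries.coeff_succ_X_mul, PowerSeries.coeff_derivative]; push_cast; ring
  rw [hx] at hc
  push_cast at hc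
  linear_combination hc

/-- With `z = e^{it}` and `w = e^{-it}`, the coefficient of `r^ℓ` in the product series is a
positive multiple of `P_ℓ (cos t)`; its Cauchy product is a nonnegative combination of the
`e^{i(j-k)t}` with `j + k = ℓ`. -/
theorem eval_cos_legendreP_eq_sum {d : ℕ} (hd : 2 ≤ d) (ℓ : ℕ) :
    ∃ a : ℕ × ℕ → ℝ, (∀ p, 0 ≤ a p) ∧ ∀ t : ℝ, (legendreP d ℓ).eval (Real.cos t) =
      ∑ p ∈ Finset.HasAntidiagonal.antidiagonal ℓ, a p * Real.cos (((p.1 : ℝ) - p.2) * t) := by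
  rcases hd.eq_or_lt with rfl | hd3
  -- At `d = 2` one has `λ = 0` and the generating function degenerates; here `P_ℓ (cos t) = cos (ℓ
  -- t)` (Chebyshev), a single term.
  · refine ⟨fun p => if p.2 = 0 then 1 else 0, fun p => by positivity, fun t => ?_⟩
    have hs : ∑ p ∈ Finset.HasAntidiagonal.antidiagonal ℓ, (if p.2 = 0 then (1 : ℝ) else 0) *
        Real.cos (((p.1 : ℝ) - p.2) * t) = Real.cos (ℓ * t) := by
      rw [Finset.sum_eq_single (ℓ, 0)]
      · simp
      · rintro ⟨i, j⟩ hp hne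
        rw [Finset.HasAntidiagonal.mem_antidiagonal] at hp
        have : j ≠ 0 := by rintro rfl; apply hne; simp at hp; simp [hp]
        simp [this]
      · intro h; exact absurd (Finset.HasAntidiagonal.mem_antidiagonal.2 (by simp)) h
    rw [hs]
    clear hs
    induction ℓ using Nat.strong_induction_on with
    | _ ℓ ih =>
      match ℓ with
      | 0 => simp [legendreP]
      | 1 => simp [legendreP]
      | m + 2 =>
        have h := eval_legendreP_add_two hd m (Real.cos t)
        rw [ih (m + 1) (by omega), ih m (by omega)] at h
        have h0 : (m : ℝ) + 1 ≠ 0 := by positivity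
        apply mul_left_cancel₀ h0
        push_cast at h ⊢
        have e1 : Real.cos (((m : ℝ) + 2) * t) = Real.cos ((m + 1) * t) * Real.cos t
            - Real.sin ((m + 1) * t) * Real.sin t := by rw [← Real.cos_add]; ring_nf
        have e2 : Real.cos ((m : ℝ) * t) = Real.cos ((m + 1) * t) * Real.cos t
            + Real.sin ((m + 1) * t) * Real.sin t := by rw [← Real.cos_sub]; ring_nf
        rw [e1]
        rw [e2] at h
        linear_combination h
  · have hd3' : (3 : ℝ) ≤ d := by exact_mod_cast hd3
    set lam : ℝ := ((d : ℝ) - 2) / 2 with hlam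
    have hpos : 0 < lam := by rw [hlam]; linarith
    -- At `t = 0` the product series is `(1 - r)^{-2λ}`, so its coefficients `N n` are the factors
    -- that normalise `P_n` to `P_n (1) = 1`.
    set N : ℕ → ℝ := negBinomCoeff (2 * lam) with hN
    have hNpos : ∀ n, 0 < N n := negBinomCoeff_pos (by positivity)
    refine ⟨fun p => negBinomCoeff lam p.1 * negBinomCoeff lam p.2 / N ℓ, fun p =>
      (div_pos (mul_pos (negBinomCoeff_pos hpos _) (negBinomCoeff_pos hpos _)) (hNpos _)).le,
      fun t => ?_⟩
    set z : ℂ := Complex.exp (t * Complex.I) with hz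
    set w : ℂ := Complex.exp (-(t * Complex.I)) with hw
    have hzw : z * w = 1 := by rw [hz, hw, ← Complex.exp_add]; simp
    have hzw2 : z + w = 2 * Complex.cos t := by
      rw [Complex.cos, hz, hw]; ring_nf
    have key : ∀ n, PowerSeries.coeff n (negBinomSeries lam z * negBinomSeries lam w) =
        (N n : ℂ) * ((legendreP d n).eval (Real.cos t) : ℝ) := by
      intro n
      induction n using Nat.strong_induction_on with
      | _ n ih =>
        match n with
        | 0 => simp [legendreP, negBinomSeries, negBinomCoeff, hN]
        | 1 =>
          simp [legendreP, negBinomSeries, negBinomCoeff, hN, PowerSeries.coeff_mul,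
            Finset.Nat.antidiagonal_succ]
          linear_combination (lam : ℂ) * hzw2
        | m + 2 =>
          have hrec := coeff_negBinomSeries_mul_recurrence lam hzw m
          rw [ih (m + 1) (by omega), ih m (by omega), hzw2, ← Complex.ofReal_cos] at hrec
          have h0 : (m : ℂ) + 2 ≠ 0 := by exact_mod_cast (by omega : m + 2 ≠ 0)
          apply mul_left_cancel₀ h0
          rw [hrec]
          have n1 := negBinomCoeff_succ (2 * lam) (m + 1)
          have n0 := negBinomCoeff_succ (2 * lam) m
          have hl := eval_legendreP_add_two hd m (Real.cos t)
          have hd' : (d : ℝ) = 2 * lam + 2 := by rw [hlam]; ring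
          rw [hd'] at hl
          rw [← hN] at n1 n0
          push_cast at n1
          have : (2 * Real.cos t) * (m + 1 + lam) * (N (m + 1) *
              (legendreP d (m + 1)).eval (Real.cos t)) - (m + 2 * lam) * (N m *
              (legendreP d m).eval (Real.cos t)) = (m + 2) * (N (m + 2) *
              (legendreP d (m + 2)).eval (Real.cos t)) := by
            linear_combination (legendreP d m).eval (Real.cos t) * n0 - N (m + 1) * hl
              - (legendreP d (m + 2)).eval (Real.cos t) * n1
          exact_mod_cast this
    have hk := key ℓ
    rw [PowerSeries.coeff_mul] at hk
    have hre := congrArg Complex.re hk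
    rw [← Complex.ofReal_mul, Complex.ofReal_re, Complex.re_sum] at hre
    have hterm : ∀ p : ℕ × ℕ, (PowerSeries.coeff p.1 (negBinomSeries lam z) *
        PowerSeries.coeff p.2 (negBinomSeries lam w)).re =
        negBinomCoeff lam p.1 * negBinomCoeff lam p.2 * Real.cos (((p.1 : ℝ) - p.2) * t) := by
      intro p
      rw [negBinomSeries, negBinomSeries, PowerSeries.coeff_mk, PowerSeries.coeff_mk]
      have : z ^ p.1 * w ^ p.2 = Complex.exp ((((p.1 : ℝ) - p.2) * t : ℝ) * Complex.I) := by
        rw [hz, hw, ← Complex.exp_nat_mul, ← Complex.exp_nat_mul, ← Complex.exp_add]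
        push_cast; ring_nf
      have e : (negBinomCoeff lam p.1 : ℂ) * z ^ p.1 * ((negBinomCoeff lam p.2 : ℂ) * w ^ p.2) =
          ((negBinomCoeff lam p.1 * negBinomCoeff lam p.2 : ℝ) : ℂ) * (z ^ p.1 * w ^ p.2) := by
        push_cast; ring
      rw [e, this, Complex.re_ofReal_mul, Complex.exp_ofReal_mul_I_re]
    rw [Finset.sum_congr rfl fun p _ => hterm p] at hre
    apply mul_left_cancel₀ (hNpos ℓ).ne'
    rw [← hre, Finset.mul_sum]
    refine Finset.sum_congr rfl fun p _ => ?_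
    have := (hNpos ℓ).ne'
    field_simp

/-! ### The trigonometric estimate and the Legendre inequality -/

theorem abs_sin_nat_mul_le (n : ℕ) (t : ℝ) : |Real.sin (n * t)| ≤ n * |Real.sin t| := by
  induction n with
  | zero => simp
  | succ n ih =>
    have e : Real.sin ((n + 1 : ℕ) * t) =
        Real.sin (n * t) * Real.cos t + Real.cos (n * t) * Real.sin t := by
      rw [← Real.sin_add]; push_cast; ring_nf
    rw [e]
    refine (abs_add_le _ _).trans ?_
    rw [abs_mul, abs_mul]
    push_cast
    nlinarith [Real.abs_cos_le_one t, Real.abs_cos_le_one (n * t), abs_nonneg (Real.sin t),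
      abs_nonneg (Real.sin (n * t))]

/-- The estimate common to both halves: it bounds the cosines in the Legendre expansion and the
Fourier multipliers of a translation. -/
theorem sin_int_mul_sq_le (n : ℤ) (t : ℝ) :
    Real.sin (n * t) ^ 2 ≤ (n : ℝ) ^ 2 * Real.sin t ^ 2 := by
  rw [← mul_pow, sq_le_sq, abs_mul]
  obtain ⟨m, rfl | rfl⟩ := n.eq_nat_or_neg
  · simpa using abs_sin_nat_mul_le m t
  · simpa using abs_sin_nat_mul_le m t

/-- The cosine weights `a p` sum to `1`, so `1 - P_ℓ (cos t)` is the same combination of the `1 -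
cos (n t)`, each at most `(n²/2) sin² t` because `n` is even. -/
theorem one_sub_eval_legendreP_le {d : ℕ} (hd : 2 ≤ d) {ℓ : ℕ} (hℓ : Even ℓ) {x : ℝ}
    (hx : x ∈ Ioo (-1 : ℝ) 1) :
    (1 - (legendreP d ℓ).eval x) / (1 - x ^ 2) ≤ (ℓ : ℝ) * (ℓ + d - 2) / (2 * ((d : ℝ) - 1)) := by
  obtain ⟨a, ha, hsum⟩ := eval_cos_legendreP_eq_sum hd ℓ
  have hder1 : ∀ t : ℝ, HasDerivAt (fun t => (legendreP d ℓ).eval (Real.cos t))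
      ((legendreP d ℓ).derivative.eval (Real.cos t) * -Real.sin t) t := fun t =>
    ((legendreP d ℓ).hasDerivAt (Real.cos t)).comp t (Real.hasDerivAt_cos t)
  have hder2 : ∀ t : ℝ, HasDerivAt (fun t => (legendreP d ℓ).eval (Real.cos t))
      (∑ p ∈ Finset.HasAntidiagonal.antidiagonal ℓ, a p * (-Real.sin (((p.1 : ℝ) - p.2) * t) *
        (((p.1 : ℝ) - p.2) * 1))) t := by
    intro t
    rw [funext hsum]
    refine HasDerivAt.fun_sum fun p _ => HasDerivAt.const_mul _ ?_
    exact ((hasDerivAt_id t).const_mul _).cos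
  have hderiv : (fun t : ℝ => (legendreP d ℓ).derivative.eval (Real.cos t) * -Real.sin t) =
      fun t => ∑ p ∈ Finset.HasAntidiagonal.antidiagonal ℓ, a p * (-Real.sin (((p.1 : ℝ) - p.2) * t) *
        (((p.1 : ℝ) - p.2) * 1)) :=
    funext fun t => (hder1 t).unique (hder2 t)
  have hd1 : HasDerivAt (fun t : ℝ => (legendreP d ℓ).derivative.eval (Real.cos t) * -Real.sin t)
      (-((legendreP d ℓ).derivative.eval 1)) 0 := by
    have h := (((legendreP d ℓ).derivative.hasDerivAt (Real.cos 0)).comp (0 : ℝ)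
      (Real.hasDerivAt_cos 0)).mul (Real.hasDerivAt_sin 0).neg
    exact h.congr_deriv (by simp)
  have hd2 : HasDerivAt (fun t : ℝ => ∑ p ∈ Finset.HasAntidiagonal.antidiagonal ℓ, a p *
      (-Real.sin (((p.1 : ℝ) - p.2) * t) * (((p.1 : ℝ) - p.2) * 1)))
      (∑ p ∈ Finset.HasAntidiagonal.antidiagonal ℓ, a p * (-(Real.cos (((p.1 : ℝ) - p.2) * 0) *
        (((p.1 : ℝ) - p.2) * 1)) * (((p.1 : ℝ) - p.2) * 1))) 0 := by
    refine HasDerivAt.fun_sum fun p _ => HasDerivAt.const_mul _ (HasDerivAt.mul_const ?_ _)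
    exact (((hasDerivAt_id (0 : ℝ)).const_mul _).sin).neg
  -- Comparison of two computations of the second derivative of `t ↦ P_ℓ (cos t)` at `0`: `-P_ℓ'
  -- (1)` and minus the weighted sum of the squared frequencies.
  have hK : ∑ p ∈ Finset.HasAntidiagonal.antidiagonal ℓ, a p * ((p.1 : ℝ) - p.2) ^ 2 =
      ℓ * (ℓ + d - 2) / ((d : ℝ) - 1) := by
    rw [hderiv] at hd1
    have := hd1.unique hd2
    rw [eval_one_derivative_legendreP hd] at this
    rw [← neg_inj, this, ← Finset.sum_neg_distrib]
    refine Finset.sum_congr rfl fun p _ => ?_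
    simp; ring
  have h1 : ∑ p ∈ Finset.HasAntidiagonal.antidiagonal ℓ, a p = 1 := by
    have := hsum 0
    simpa [eval_one_legendreP hd] using this.symm
  have hx2 : 0 < 1 - x ^ 2 := by nlinarith [hx.1, hx.2]
  rw [div_le_iff₀ hx2]
  have hcos : Real.cos (Real.arccos x) = x := Real.cos_arccos hx.1.le hx.2.le
  set t := Real.arccos x
  have hsin : Real.sin t ^ 2 = 1 - x ^ 2 := by rw [Real.sin_sq, hcos]
  calc 1 - (legendreP d ℓ).eval x
      = ∑ p ∈ Finset.HasAntidiagonal.antidiagonal ℓ, a p * (1 - Real.cos (((p.1 : ℝ) - p.2) * t)) := by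
        simp only [mul_sub, mul_one, Finset.sum_sub_distrib, h1, ← hsum t, hcos]
    _ ≤ ∑ p ∈ Finset.HasAntidiagonal.antidiagonal ℓ, a p * ((((p.1 : ℝ) - p.2) ^ 2 / 2) * Real.sin t ^ 2) := by
        refine Finset.sum_le_sum fun p hp => mul_le_mul_of_nonneg_left ?_ (ha p)
        rw [Finset.HasAntidiagonal.mem_antidiagonal] at hp
        -- The parity of `ℓ` enters here: `p.1 + p.2 = ℓ` is even, hence so is the frequency `p.1 -
        -- p.2`.
        obtain ⟨m, hm⟩ : Even ((p.1 : ℤ) - p.2) := by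
          rw [Int.even_sub, Int.even_coe_nat, Int.even_coe_nat]
          rw [← hp, Nat.even_add] at hℓ
          exact hℓ
        have hm' : (p.1 : ℝ) - p.2 = 2 * m := by
          have : (((p.1 : ℤ) - p.2 : ℤ) : ℝ) = ((m + m : ℤ) : ℝ) := by rw [hm]
          push_cast at this; linarith
        have := sin_int_mul_sq_le m t
        rw [hm', mul_assoc, Real.cos_two_mul, Real.cos_sq']
        nlinarith
    _ = (∑ p ∈ Finset.HasAntidiagonal.antidiagonal ℓ, a p * ((p.1 : ℝ) - p.2) ^ 2) * (1 - x ^ 2) / 2 := by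
        rw [hsin, Finset.sum_mul, Finset.sum_div]
        exact Finset.sum_congr rfl fun p _ => by ring
    _ = _ := by
        have : (d : ℝ) - 1 ≠ 0 := by have : (2 : ℝ) ≤ d := by exact_mod_cast hd
                                     linarith
        rw [hK]; field_simp

theorem one_sub_eval_legendreP_two {d : ℕ} (hd : 2 ≤ d) {x : ℝ} (hx : x ∈ Ioo (-1 : ℝ) 1) :
    (1 - (legendreP d 2).eval x) / (1 - x ^ 2) =
      ((2 : ℕ) : ℝ) * ((2 : ℕ) + d - 2) / (2 * ((d : ℝ) - 1)) := by
  have h2 : (2 : ℝ) ≤ d := by exact_mod_cast hd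
  have h1 : (d : ℝ) - 1 ≠ 0 := by linarith
  have hx2 : 1 - x ^ 2 ≠ 0 := by nlinarith [hx.1, hx.2]
  have h := eval_legendreP_add_two hd 0 x
  simp [legendreP] at h
  have h' : (legendreP d 2).eval x = (d * x * x - 1) / ((d : ℝ) - 1) := by
    rw [eq_div_iff h1]; simp only [legendreP]; simp; linear_combination h
  rw [h']
  field_simp
  push_cast
  ring

/-- Since `1 - x² = (1 - x)(1 + x)`, the quotient is the slope of `P_ℓ` at `1` divided by `1 + x`,
with limit `P_ℓ' (1) / 2`. -/
theorem tendsto_one_sub_eval_legendreP_one {d : ℕ} (hd : 2 ≤ d) (ℓ : ℕ) :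
    Tendsto (fun x : ℝ => (1 - (legendreP d ℓ).eval x) / (1 - x ^ 2)) (𝓝[≠] 1)
      (𝓝 ((ℓ : ℝ) * (ℓ + d - 2) / (2 * ((d : ℝ) - 1)))) := by
  have hs := hasDerivAt_iff_tendsto_slope.1 ((legendreP d ℓ).hasDerivAt 1)
  have hq : Tendsto (fun x : ℝ => 1 + x) (𝓝[≠] 1) (𝓝 (1 + 1)) :=
    (Continuous.tendsto (by fun_prop) 1).mono_left nhdsWithin_le_nhds
  have h := hs.div hq (by norm_num)
  rw [eval_one_derivative_legendreP hd] at h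
  have e : (ℓ : ℝ) * (ℓ + d - 2) / ((d : ℝ) - 1) / (1 + 1) =
      (ℓ : ℝ) * (ℓ + d - 2) / (2 * ((d : ℝ) - 1)) := by
    rw [div_div]; ring_nf
  rw [e] at h
  refine h.congr' ?_
  filter_upwards [self_mem_nhdsWithin] with x hx
  have hx1 : x - 1 ≠ 0 := sub_ne_zero.2 hx
  simp only [Pi.div_apply]
  rw [slope_def_field, eval_one_legendreP hd, div_div, ← neg_div_neg_eq]
  congr 1 <;> ring

theorem tendsto_one_sub_eval_legendreP_neg_one {d : ℕ} (hd : 2 ≤ d) {ℓ : ℕ} (hℓ : Even ℓ) :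
    Tendsto (fun x : ℝ => (1 - (legendreP d ℓ).eval x) / (1 - x ^ 2)) (𝓝[>] (-1))
      (𝓝 ((ℓ : ℝ) * (ℓ + d - 2) / (2 * ((d : ℝ) - 1)))) := by
  have hneg : Tendsto (fun x : ℝ => -x) (𝓝[>] (-1)) (𝓝[≠] 1) := by
    refine tendsto_nhdsWithin_iff.2 ⟨?_, ?_⟩
    · have : Tendsto (fun x : ℝ => -x) (𝓝 (-1)) (𝓝 (- -1)) := continuous_neg.tendsto _
      rw [neg_neg] at this
      exact this.mono_left nhdsWithin_le_nhds
    · filter_upwards [self_mem_nhdsWithin] with x hx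
      have : -1 < x := hx
      simp only [mem_compl_iff, mem_singleton_iff]
      linarith
  refine ((tendsto_one_sub_eval_legendreP_one hd ℓ).comp hneg).congr fun x => ?_
  simp only [Function.comp]
  rw [eval_neg_legendreP hd, hℓ.neg_one_pow]
  ring_nf

/-! ### Fourier series of `π`-periodic functions -/

theorem norm_exp_two_mul_int_sub_one_sq_le (n : ℤ) (t : ℝ) :
    ‖Complex.exp (2 * n * t * Complex.I) - 1‖ ^ 2 ≤ 4 * (n : ℝ) ^ 2 * Real.sin t ^ 2 := by
  have e : (2 * n * t * Complex.I : ℂ) = ((2 * (n * t) : ℝ) : ℂ) * Complex.I := by push_cast; ring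
  rw [e, Complex.sq_norm, Complex.normSq_apply, Complex.sub_re, Complex.sub_im,
    Complex.exp_ofReal_mul_I_re, Complex.exp_ofReal_mul_I_im, Complex.one_re, Complex.one_im,
    Real.cos_two_mul, Real.sin_two_mul]
  have h := sin_int_mul_sq_le n t
  have hs := Real.sin_sq_add_cos_sq (n * t)
  have h2 : (2 * Real.cos (n * t) ^ 2 - 1 - 1) * (2 * Real.cos (n * t) ^ 2 - 1 - 1) +
      (2 * Real.sin (n * t) * Real.cos (n * t) - 0) * (2 * Real.sin (n * t) * Real.cos (n * t) - 0)
      = 4 * Real.sin (n * t) ^ 2 := by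
    have hc : Real.cos (n * t) ^ 2 = 1 - Real.sin (n * t) ^ 2 := by linarith
    linear_combination (4 * Real.cos (n * t) ^ 2 - 4) * hc
  rw [h2]
  linarith

theorem fourierCoeffOn_pi_eq (f : ℝ → ℂ) (n : ℤ) :
    fourierCoeffOn Real.pi_pos f n =
      (1 / Real.pi) • ∫ x in (0 : ℝ)..Real.pi, Complex.exp (-(2 * n * x * Complex.I)) * f x := by
  rw [fourierCoeffOn_eq_integral, sub_zero]
  congr 1
  refine intervalIntegral.integral_congr fun x _ => ?_
  simp only [smul_eq_mul]
  rw [fourier_coe_apply]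
  congr 2
  have : (Real.pi : ℂ) ≠ 0 := by exact_mod_cast Real.pi_ne_zero
  push_cast
  field_simp

/-- Translation multiplies the mode of frequency `2n` by `e^{2int}`; periodicity brings the shifted
window of integration back to `[0, π]`. -/
theorem fourierCoeffOn_pi_translate_sub {f : ℝ → ℂ} (hf : Continuous f)
    (hper : Function.Periodic f Real.pi) (t : ℝ) (n : ℤ) :
    fourierCoeffOn Real.pi_pos (fun x => f (x + t) - f x) n =
      (Complex.exp (2 * n * t * Complex.I) - 1) * fourierCoeffOn Real.pi_pos f n := by
  rw [fourierCoeffOn_pi_eq, fourierCoeffOn_pi_eq]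
  set e : ℝ → ℂ := fun x => Complex.exp (-(2 * n * x * Complex.I)) * f x with he
  have hec : Continuous e := by rw [he]; fun_prop
  have hep : Function.Periodic e Real.pi := by
    intro x
    simp only [he]
    rw [hper x]
    congr 1
    have : (-(2 * n * ((x + Real.pi : ℝ) : ℂ) * Complex.I) : ℂ) =
        -(2 * n * x * Complex.I) + (-n : ℤ) * (2 * Real.pi * Complex.I) := by push_cast; ring
    rw [this, Complex.exp_periodic.int_mul]
  have h1 : ∀ x : ℝ, Complex.exp (-(2 * n * x * Complex.I)) * (f (x + t) - f x) =
      Complex.exp (2 * n * t * Complex.I) * e (x + t) - e x := by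
    intro x
    simp only [he]
    rw [mul_sub, ← mul_assoc, ← Complex.exp_add]
    congr 3
    push_cast; ring
  have h2 : ∫ x in (0 : ℝ)..Real.pi, e (x + t) = ∫ x in (0 : ℝ)..Real.pi, e x := by
    rw [intervalIntegral.integral_comp_add_right, zero_add, add_comm Real.pi t]
    simpa using hep.intervalIntegral_add_eq t 0
  simp only [h1]
  rw [intervalIntegral.integral_sub, intervalIntegral.integral_const_mul, h2]
  · rw [Complex.real_smul, Complex.real_smul]; ring
  · exact Continuous.intervalIntegrable (by fun_prop) _ _
  · exact Continuous.intervalIntegrable (by fun_prop) _ _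

theorem fourierCoeffOn_pi_of_hasDerivAt {f f' : ℝ → ℂ} (hf : ∀ x, HasDerivAt f (f' x) x)
    (hf' : Continuous f') (hper : Function.Periodic f Real.pi) (n : ℤ) :
    fourierCoeffOn Real.pi_pos f' n =
      2 * n * Complex.I * fourierCoeffOn Real.pi_pos f n := by
  have hpi : (Real.pi : ℂ) ≠ 0 := by exact_mod_cast Real.pi_ne_zero
  have h0 : f Real.pi - f 0 = 0 := by simpa [sub_eq_zero] using hper 0
  -- The integration-by-parts formula divides by `n`; the zero mode vanishes separately, `f'` having
  -- mean zero over a period.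
  rcases eq_or_ne n 0 with rfl | hn
  · rw [fourierCoeffOn_pi_eq]
    have : ∫ x in (0 : ℝ)..Real.pi, f' x = 0 := by
      rw [intervalIntegral.integral_eq_sub_of_hasDerivAt (fun x _ => hf x)
        (hf'.intervalIntegrable _ _), h0]
    simp [this]
  · rw [fourierCoeffOn_of_hasDerivAt Real.pi_pos hn (fun x _ => hf x)
      (hf'.intervalIntegrable _ _), h0]
    have hn' : (n : ℂ) ≠ 0 := by exact_mod_cast hn
    have hI := Complex.I_ne_zero
    push_cast
    field_simp
    ring

/-- A sharp difference inequality for `π`-periodic functions. -/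
theorem integral_sq_translate_sub_le {u u' : ℝ → ℝ} (hu : ∀ x, HasDerivAt u (u' x) x)
    (hu' : Continuous u') (hper : Function.Periodic u Real.pi) (t : ℝ) :
    ∫ x in (0 : ℝ)..Real.pi, (u (x + t) - u x) ^ 2 ≤
      Real.sin t ^ 2 * ∫ x in (0 : ℝ)..Real.pi, u' x ^ 2 := by
  set f : ℝ → ℂ := fun x => (u x : ℂ) with hf
  set f' : ℝ → ℂ := fun x => (u' x : ℂ) with hf'
  have hder : ∀ x, HasDerivAt f (f' x) x := fun x => (hu x).ofReal_comp
  have hf'c : Continuous f' := Complex.continuous_ofReal.comp hu'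
  have huc : Continuous u := continuous_iff_continuousAt.2 fun x => (hu x).continuousAt
  have hfc : Continuous f := Complex.continuous_ofReal.comp huc
  have hfper : Function.Periodic f Real.pi := fun x => by simp only [hf]; rw [hper x]
  have hmem : ∀ h : ℝ → ℂ, Continuous h → MemLp h 2 (volume.restrict (Ioc 0 Real.pi)) := by
    intro h hh
    refine MemLp.mono_measure (Measure.restrict_mono_set _ Ioc_subset_Icc_self) ?_
    obtain ⟨C, hC⟩ := isCompact_Icc.exists_bound_of_continuousOn (s := Icc 0 Real.pi) hh.continuousOn
    exact MemLp.of_bound hh.aestronglyMeasurable C (ae_restrict_of_forall_mem measurableSet_Icc hC)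
  -- Parseval on both sides reduces the claim to a comparison of multipliers, mode by mode.
  have h1 := hasSum_sq_fourierCoeffOn Real.pi_pos
    (hmem (fun x => f (x + t) - f x) (by fun_prop))
  have h2 := (hasSum_sq_fourierCoeffOn Real.pi_pos (hmem f' hf'c)).mul_left (Real.sin t ^ 2)
  have hle := hasSum_le (fun n => ?_) h1 h2
  · have e1 : ∀ x, ‖f (x + t) - f x‖ ^ 2 = (u (x + t) - u x) ^ 2 := fun x => by
      simp only [hf]; rw [← Complex.ofReal_sub, Complex.norm_real, Real.norm_eq_abs, sq_abs]
    have e2 : ∀ x, ‖f' x‖ ^ 2 = u' x ^ 2 := fun x => by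
      simp only [hf']; rw [Complex.norm_real, Real.norm_eq_abs, sq_abs]
    simp only [e1, e2, sub_zero, smul_eq_mul] at hle
    rw [mul_left_comm] at hle
    exact le_of_mul_le_mul_left hle (inv_pos.2 Real.pi_pos)
  -- Needed: `|e^{2int} - 1|² ≤ sin² t · |2in|²`. Period `π` is essential: a mode of frequency `1`
  -- would violate the bound at `t = π`.
  · rw [fourierCoeffOn_pi_translate_sub hfc hfper, fourierCoeffOn_pi_of_hasDerivAt hder hf'c hfper,
      norm_mul, mul_pow, norm_mul, mul_pow, ← mul_assoc]
    refine mul_le_mul_of_nonneg_right ?_ (sq_nonneg _)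
    refine (norm_exp_two_mul_int_sub_one_sq_le n t).trans_eq ?_
    simp [mul_pow]
    ring

/-! ### Averages over the orthogonal group -/

/-- The orthogonal group of `ℝᵈ`. -/
abbrev OrthGroup (d : ℕ) : Type := unitary (Euc d →L[ℝ] Euc d)

instance continuousStar_endEuc (d : ℕ) : ContinuousStar (Euc d →L[ℝ] Euc d) where
  continuous_star := (ContinuousLinearMap.adjoint (𝕜 := ℝ) (E := Euc d) (F := Euc d)).continuous

theorem norm_orth_apply {d : ℕ} (R : OrthGroup d) (x : Euc d) : ‖R.1 x‖ = ‖x‖ :=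
  Unitary.norm_map R x

theorem inner_orth_apply {d : ℕ} (R : OrthGroup d) (x y : Euc d) : ⟪R.1 x, R.1 y⟫ = ⟪x, y⟫ :=
  Unitary.inner_map_map R x y

instance compactSpace_orthGroup (d : ℕ) : CompactSpace (OrthGroup d) := by
  refine isCompact_iff_compactSpace.1 (Metric.isCompact_of_isClosed_isBounded isClosed_unitary ?_)
  refine (Metric.isBounded_closedBall (x := (0 : Euc d →L[ℝ] Euc d)) (r := 1)).subset ?_
  intro R hR
  rw [mem_closedBall_zero_iff]
  refine ContinuousLinearMap.opNorm_le_bound _ zero_le_one fun x => ?_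
  rw [one_mul]
  exact (norm_orth_apply ⟨R, hR⟩ x).le

/-- The right-invariant probability measure on the orthogonal group. -/
noncomputable def orthMeasure (d : ℕ) : Measure (OrthGroup d) :=
  (Measure.haarMeasure (⊤ : TopologicalSpace.PositiveCompacts (OrthGroup d))).inv

instance isMulRightInvariant_orthMeasure (d : ℕ) : (orthMeasure d).IsMulRightInvariant := by
  unfold orthMeasure; infer_instance

instance isProbabilityMeasure_orthMeasure (d : ℕ) : IsProbabilityMeasure (orthMeasure d) := by
  refine ⟨?_⟩
  rw [orthMeasure, Measure.inv_apply, inv_univ]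
  exact Measure.haarMeasure_self (K₀ := (⊤ : TopologicalSpace.PositiveCompacts (OrthGroup d)))

/-- The action of the orthogonal group on the sphere. -/
def orthAct {d : ℕ} (R : OrthGroup d) (x : Sph d) : Sph d :=
  ⟨R.1 x, by rw [mem_sphere_zero_iff_norm, norm_orth_apply, norm_eq_of_mem_sphere]⟩

@[simp]
theorem coe_orthAct {d : ℕ} (R : OrthGroup d) (x : Sph d) : (orthAct R x : Euc d) = R.1 x := rfl

theorem continuous_orthAct {d : ℕ} :
    Continuous fun p : OrthGroup d × Sph d => orthAct p.1 p.2 := by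
  refine Continuous.subtype_mk ?_ _
  exact (continuous_subtype_val.comp continuous_fst).clm_apply
    (continuous_subtype_val.comp continuous_snd)

theorem sdot_orthAct {d : ℕ} (R : OrthGroup d) (x y : Sph d) :
    sdot (orthAct R x) (orthAct R y) = sdot x y := inner_orth_apply R x y

open scoped Pointwise in
theorem measurePreserving_orthAct {d : ℕ} (R : OrthGroup d) :
    MeasurePreserving (orthAct R) (surf d) (surf d) := by
  have hm : Measurable (orthAct R) :=
    (continuous_orthAct.comp (Continuous.prodMk_right R)).measurable
  refine ⟨hm, Measure.ext fun s hs => ?_⟩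
  rw [Measure.map_apply hm hs, surf, Measure.toSphere_apply' _ (hm hs),
    Measure.toSphere_apply' _ hs]
  congr 1
  set e := Unitary.linearIsometryEquiv R with he
  have heq : ∀ x, e x = R.1 x := fun x => rfl
  -- `toSphere` measures a set through the volume of the cone over it. Rotations commute with
  -- scaling, so they carry cones to cones, and they preserve volume.
  have : Ioo (0 : ℝ) 1 • ((↑) '' (orthAct R ⁻¹' s) : Set (Euc d)) =
      e ⁻¹' (Ioo (0 : ℝ) 1 • ((↑) '' s : Set (Euc d))) := by
    ext x
    simp only [Set.mem_smul, mem_preimage, mem_image]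
    constructor
    · rintro ⟨r, hr, y, ⟨z, hz, rfl⟩, rfl⟩
      exact ⟨r, hr, _, ⟨_, hz, rfl⟩, by rw [heq, map_smul, coe_orthAct]⟩
    · rintro ⟨r, hr, y, ⟨z, hz, rfl⟩, h⟩
      refine ⟨r, hr, e.symm z, ⟨⟨e.symm z, ?_⟩, ?_, rfl⟩, ?_⟩
      · rw [mem_sphere_zero_iff_norm, e.symm.norm_map, norm_eq_of_mem_sphere]
      · convert hz
        exact Subtype.ext (e.apply_symm_apply _)
      · apply e.injective
        rw [map_smul, e.apply_symm_apply, h]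
  rw [this]
  exact e.measurePreserving.measure_preimage_equiv (f := e.toMeasurableEquiv) _

theorem lintegral_orthAct {d : ℕ} (R : OrthGroup d) (h : Sph d → ℝ≥0∞) (hh : Measurable h) :
    ∫⁻ x, h (orthAct R x) ∂(surf d) = ∫⁻ x, h x ∂(surf d) :=
  (measurePreserving_orthAct R).lintegral_comp hh

/-- The reflection exchanging `a` and `a'` works. Its fixed hyperplane is recorded so that a second
reflection can move another vector without disturbing the first image. -/
theorem exists_orth_apply_eq {d : ℕ} {a a' : Euc d} (h : ‖a‖ = ‖a'‖) :
    ∃ Q : OrthGroup d, Q.1 a = a' ∧ ∀ c, ⟪c, a⟫ = ⟪c, a'⟫ → Q.1 c = c := by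
  refine ⟨Unitary.linearIsometryEquiv.symm (ℝ ∙ (a - a'))ᗮ.reflection,
    Submodule.reflection_sub h, fun c hc => ?_⟩
  refine Submodule.reflection_mem_subspace_eq_self ?_
  rw [Submodule.mem_orthogonal_singleton_iff_inner_left, inner_sub_right, hc, sub_self]

theorem exists_orth_apply_eq_pair {d : ℕ} {a b a' b' : Euc d} (ha : ‖a‖ = ‖a'‖) (hb : ‖b‖ = ‖b'‖)
    (h : ⟪a, b⟫ = 0) (h' : ⟪a', b'⟫ = 0) : ∃ Q : OrthGroup d, Q.1 a = a' ∧ Q.1 b = b' := by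
  obtain ⟨Q, hQ, -⟩ := exists_orth_apply_eq ha
  obtain ⟨Q', hQ', hfix⟩ := exists_orth_apply_eq (a := Q.1 b) (a' := b')
    (by rw [norm_orth_apply, hb])
  refine ⟨Q' * Q, ?_, hQ'⟩
  change Q'.1 (Q.1 a) = a'
  rw [hQ]
  exact hfix _ (by rw [← hQ, inner_orth_apply, h, hQ, h'])

theorem lintegral_orth_mul_right {d : ℕ} (Q : OrthGroup d) (F : OrthGroup d → ℝ≥0∞) :
    ∫⁻ R, F (R * Q) ∂(orthMeasure d) = ∫⁻ R, F R ∂(orthMeasure d) :=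
  lintegral_mul_right_eq_self F Q

/-- The orthogonal group is transitive on orthogonal pairs of prescribed lengths. The transporting
map acts before `R`, which is why right invariance of the measure is required. -/
theorem lintegral_orth_pair_eq {d : ℕ} (F : Euc d → Euc d → ℝ≥0∞) {a b a' b' : Euc d}
    (ha : ‖a‖ = ‖a'‖) (hb : ‖b‖ = ‖b'‖) (h : ⟪a, b⟫ = 0) (h' : ⟪a', b'⟫ = 0) :
    ∫⁻ R, F (R.1 a) (R.1 b) ∂(orthMeasure d) = ∫⁻ R, F (R.1 a') (R.1 b') ∂(orthMeasure d) := by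
  obtain ⟨Q, hQ, hQ'⟩ := exists_orth_apply_eq_pair ha hb h h'
  rw [← lintegral_orth_mul_right Q, ← hQ, ← hQ']
  rfl

/-- Integrate `h (R σ)` over both variables: the `σ`-integral does not depend on `R` by invariance
of `surf`, the `R`-integral does not depend on `σ` by transitivity. -/
theorem lintegral_surf_eq_lintegral_orth {d : ℕ} {h : Sph d → ℝ≥0∞} (hh : Measurable h)
    (x : Sph d) :
    ∫⁻ σ, h σ ∂(surf d) = surf d univ * ∫⁻ R, h (orthAct R x) ∂(orthMeasure d) := by
  have : IsFiniteMeasure (surf d) := by unfold surf; infer_instance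
  calc ∫⁻ σ, h σ ∂(surf d) = ∫⁻ _R, ∫⁻ σ, h σ ∂(surf d) ∂(orthMeasure d) := by simp
    _ = ∫⁻ R, ∫⁻ σ, h (orthAct R σ) ∂(surf d) ∂(orthMeasure d) :=
        lintegral_congr fun R => (lintegral_orthAct R h hh).symm
    _ = ∫⁻ σ, ∫⁻ R, h (orthAct R σ) ∂(orthMeasure d) ∂(surf d) :=
        lintegral_lintegral_swap (hh.comp continuous_orthAct.measurable).aemeasurable
    _ = ∫⁻ _σ, ∫⁻ R, h (orthAct R x) ∂(orthMeasure d) ∂(surf d) := by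
        refine lintegral_congr fun σ => ?_
        obtain ⟨Q, hQ, -⟩ := exists_orth_apply_eq (a := (x : Euc d)) (a' := (σ : Euc d))
          (by rw [norm_eq_of_mem_sphere, norm_eq_of_mem_sphere])
        rw [← lintegral_orth_mul_right Q fun R => h (orthAct R x)]
        refine lintegral_congr fun R => congrArg h (Subtype.ext ?_)
        change R.1 σ = R.1 (Q.1 x)
        rw [hQ]
    _ = _ := by rw [lintegral_const, mul_comm]

theorem lintegral_comp_sdot {d : ℕ} {f : ℝ → ℝ≥0∞} (hf : Measurable f) (x k : Sph d) :
    ∫⁻ σ, f (sdot x σ) ∂(surf d) = ∫⁻ σ, f (sdot k σ) ∂(surf d) := by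
  obtain ⟨Q, hQ, -⟩ := exists_orth_apply_eq (a := (x : Euc d)) (a' := (k : Euc d))
    (by rw [norm_eq_of_mem_sphere, norm_eq_of_mem_sphere])
  have hm : Measurable fun σ => f (sdot k σ) :=
    hf.comp (Continuous.measurable (by unfold sdot; fun_prop))
  rw [← lintegral_orthAct Q _ hm]
  refine lintegral_congr fun σ => ?_
  have : k = orthAct Q x := Subtype.ext hQ.symm
  rw [this, sdot_orthAct]

/-! ### The `0`-homogeneous extension and its gradient -/

instance isFiniteMeasure_surf (d : ℕ) : IsFiniteMeasure (surf d) := by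
  unfold surf; infer_instance

instance isOpenPosMeasure_surf (d : ℕ) : (surf d).IsOpenPosMeasure := by
  unfold surf; infer_instance

theorem coe_sph_ne_zero {d : ℕ} (σ : Sph d) : (σ : Euc d) ≠ 0 := by
  rw [← norm_ne_zero_iff, norm_eq_of_mem_sphere]; exact one_ne_zero

theorem radialExt_smul_coe {d : ℕ} (g : Sph d → ℝ) {c : ℝ} (hc : 0 < c) (σ : Sph d) :
    radialExt g (c • (σ : Euc d)) = g σ := by
  have h0 : c • (σ : Euc d) ≠ 0 := smul_ne_zero hc.ne' (coe_sph_ne_zero σ)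
  rw [radialExt, dif_neg h0]
  congr 1
  ext1
  simp only
  rw [norm_smul, norm_eq_of_mem_sphere, mul_one, Real.norm_of_nonneg hc.le, smul_smul,
    inv_mul_cancel₀ hc.ne', one_smul]

@[simp]
theorem radialExt_coe {d : ℕ} (g : Sph d → ℝ) (σ : Sph d) : radialExt g (σ : Euc d) = g σ := by
  simpa using radialExt_smul_coe g one_pos σ

theorem exists_eq_smul_coe {d : ℕ} {x : Euc d} (hx : x ≠ 0) :
    ∃ σ : Sph d, x = ‖x‖ • (σ : Euc d) := by
  have h : ‖x‖ ≠ 0 := norm_ne_zero_iff.2 hx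
  refine ⟨⟨‖x‖⁻¹ • x, ?_⟩, ?_⟩
  · rw [mem_sphere_zero_iff_norm, norm_smul, norm_inv, norm_norm, inv_mul_cancel₀ h]
  · simp only
    rw [smul_smul, mul_inv_cancel₀ h, one_smul]

theorem radialExt_smul {d : ℕ} (g : Sph d → ℝ) {c : ℝ} (hc : 0 < c) (x : Euc d) :
    radialExt g (c • x) = radialExt g x := by
  rcases eq_or_ne x 0 with rfl | hx
  · rw [smul_zero]
  · obtain ⟨σ, hσ⟩ := exists_eq_smul_coe hx
    have hn := norm_pos_iff.2 hx
    rw [hσ, smul_smul, radialExt_smul_coe g hn, radialExt_smul_coe g (mul_pos hc hn)]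

theorem radialExt_neg {d : ℕ} {g : Sph d → ℝ} (hg : ∀ σ, g (-σ) = g σ) (x : Euc d) :
    radialExt g (-x) = radialExt g x := by
  rcases eq_or_ne x 0 with rfl | hx
  · rw [neg_zero]
  · obtain ⟨σ, hσ⟩ := exists_eq_smul_coe hx
    have hn := norm_pos_iff.2 hx
    have : -x = ‖x‖ • ((-σ : Sph d) : Euc d) := by
      rw [show ((-σ : Sph d) : Euc d) = -(σ : Euc d) from rfl, smul_neg, ← hσ]
    rw [this, radialExt_smul_coe g hn, hg, ← radialExt_smul_coe g hn σ, ← hσ]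

theorem SphContDiff.of_le {d : ℕ} {m n : ℕ∞} {g : Sph d → ℝ} (hg : SphContDiff n g)
    (h : m ≤ n) : SphContDiff m g :=
  ContDiffOn.of_le hg (by exact_mod_cast h)

theorem inner_gradient_eq {d : ℕ} (f : Euc d → ℝ) (x v : Euc d) :
    ⟪gradient f x, v⟫ = fderiv ℝ f x v := by
  rw [gradient, InnerProductSpace.toDual_symm_apply]

theorem SphContDiff.differentiableAt {d : ℕ} {g : Sph d → ℝ} (hg : SphContDiff 1 g)
    {x : Euc d} (hx : x ≠ 0) :
    DifferentiableAt ℝ (radialExt g) x :=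
  (ContDiffOn.contDiffAt hg (isOpen_compl_singleton.mem_nhds hx)).differentiableAt (by simp)

theorem SphContDiff.continuousOn_gradient {d : ℕ} {g : Sph d → ℝ} (hg : SphContDiff 1 g) :
    ContinuousOn (gradient (radialExt g)) {0}ᶜ := by
  have h := ContDiffOn.continuousOn_fderiv_of_isOpen hg isOpen_compl_singleton (by simp)
  exact (InnerProductSpace.toDual ℝ (Euc d)).symm.continuous.comp_continuousOn h

theorem SphContDiff.continuous_sphGrad {d : ℕ} {g : Sph d → ℝ} (hg : SphContDiff 1 g) :
    Continuous (sphGrad g) :=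
  hg.continuousOn_gradient.comp_continuous continuous_subtype_val coe_sph_ne_zero

theorem SphContDiff.continuous {d : ℕ} {g : Sph d → ℝ} (hg : SphContDiff 1 g) :
    Continuous g := by
  have h : ContinuousOn (radialExt g) {0}ᶜ := ContDiffOn.continuousOn hg
  exact (h.comp_continuous continuous_subtype_val coe_sph_ne_zero).congr (radialExt_coe g)

/-- The extension is constant along rays, so its Euclidean gradient has no radial part. -/
theorem SphContDiff.inner_gradient_self {d : ℕ} {g : Sph d → ℝ} (hg : SphContDiff 1 g)
    {x : Euc d} (hx : x ≠ 0) :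
    ⟪gradient (radialExt g) x, x⟫ = 0 := by
  rw [inner_gradient_eq]
  have h1 : HasDerivAt (fun t : ℝ => radialExt g (x + t • x)) (fderiv ℝ (radialExt g) x x) 0 := by
    have h : HasDerivAt (fun t : ℝ => x + t • x) x 0 := by
      simpa using ((hasDerivAt_id (0 : ℝ)).smul_const x).const_add x
    have h' : HasFDerivAt (radialExt g) (fderiv ℝ (radialExt g) x) (x + (0 : ℝ) • x) := by
      simpa using (hg.differentiableAt hx).hasFDerivAt
    exact h'.comp_hasDerivAt 0 h
  have h2 : HasDerivAt (fun t : ℝ => radialExt g (x + t • x)) 0 0 := by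
    refine (hasDerivAt_const (0 : ℝ) (radialExt g x)).congr_of_eventuallyEq ?_
    filter_upwards [Ioi_mem_nhds (show (-1 : ℝ) < 0 by norm_num)] with t ht
    have : x + t • x = (1 + t) • x := by rw [add_smul, one_smul]
    rw [this, radialExt_smul]
    have : -1 < t := ht
    linarith
  exact h1.unique h2

/-! ### Mean squares along great circles -/

theorem norm_cos_smul_add_sin_smul {d : ℕ} {a b : Euc d} (ha : ‖a‖ = 1) (hb : ‖b‖ = 1)
    (h : ⟪a, b⟫ = 0) (s : ℝ) : ‖Real.cos s • a + Real.sin s • b‖ = 1 := by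
  have : ‖Real.cos s • a + Real.sin s • b‖ ^ 2 = 1 := by
    rw [norm_add_sq_real, norm_smul, norm_smul, ha, hb, inner_smul_left, inner_smul_right, h]
    simp
  exact (pow_eq_one_iff_of_nonneg (norm_nonneg _) two_ne_zero).1 this

theorem lintegral_ofReal_intervalIntegral {f : ℝ → ℝ} (hf : Continuous f) (h0 : ∀ x, 0 ≤ f x)
    {a b : ℝ} (hab : a ≤ b) :
    ∫⁻ x in Ioc a b, ENNReal.ofReal (f x) = ENNReal.ofReal (∫ x in a..b, f x) := by
  rw [intervalIntegral.integral_of_le hab, ofReal_integral_eq_lintegral_ofReal]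
  · exact (hf.integrableOn_Icc).mono_set Ioc_subset_Icc_self
  · exact Eventually.of_forall h0

/-- The sharp mean square inequality between the increment along an arc of a great circle and the
derivative along the great circle. -/
theorem lintegral_orth_sq_sub_le {d : ℕ} {g : Sph d → ℝ} (hg : SphContDiff 1 g)
    (heven : ∀ σ, g (-σ) = g σ) {a b : Euc d} (ha : ‖a‖ = 1) (hb : ‖b‖ = 1) (hab : ⟪a, b⟫ = 0)
    (t : ℝ) :
    ∫⁻ R, ENNReal.ofReal ((radialExt g (R.1 (Real.cos t • a + Real.sin t • b)) -
        radialExt g (R.1 a)) ^ 2) ∂(orthMeasure d) ≤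
      ENNReal.ofReal (Real.sin t ^ 2) *
        ∫⁻ R, ENNReal.ofReal (⟪gradient (radialExt g) (R.1 a), R.1 b⟫ ^ 2) ∂(orthMeasure d) := by
  set f := radialExt g with hf
  -- The great circle through `a` with initial velocity `b`; `(γ s, γ' s)` is an orthonormal pair
  -- for every `s`.
  set γ : ℝ → Euc d := fun s => Real.cos s • a + Real.sin s • b with hγ
  set γ' : ℝ → Euc d := fun s => -Real.sin s • a + Real.cos s • b with hγ'
  have hγc : Continuous γ := by rw [hγ]; fun_prop
  have hγc' : Continuous γ' := by rw [hγ']; fun_prop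
  have hγn : ∀ s, ‖γ s‖ = 1 := norm_cos_smul_add_sin_smul ha hb hab
  have hγ0 : ∀ (R : OrthGroup d) s, R.1 (γ s) ≠ 0 := fun R s => by
    rw [← norm_ne_zero_iff, norm_orth_apply, hγn]; exact one_ne_zero
  have hγd : ∀ s, HasDerivAt γ (γ' s) s := fun s =>
    ((Real.hasDerivAt_cos s).smul_const a).add ((Real.hasDerivAt_sin s).smul_const b)
  have hγn' : ∀ s, ‖γ' s‖ = 1 := fun s => by
    have : γ' s = Real.cos (s + Real.pi / 2) • a + Real.sin (s + Real.pi / 2) • b := by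
      rw [Real.cos_add_pi_div_two, Real.sin_add_pi_div_two]
    rw [this]; exact norm_cos_smul_add_sin_smul ha hb hab _
  have hγγ' : ∀ s, ⟪γ s, γ' s⟫ = 0 := fun s => by
    simp only [hγ, hγ', inner_add_left, inner_add_right, inner_smul_left, inner_smul_right, hab,
      real_inner_comm a b, real_inner_self_eq_norm_sq, ha, hb]
    simp; ring
  have hγadd : ∀ s, γ (s + t) = Real.cos t • γ s + Real.sin t • γ' s := fun s => by
    simp only [hγ, hγ', Real.cos_add, Real.sin_add]; module
  have happ : Continuous fun p : OrthGroup d × ℝ => p.1.1 (γ p.2) :=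
    (continuous_subtype_val.comp continuous_fst).clm_apply (hγc.comp continuous_snd)
  have happ' : Continuous fun p : OrthGroup d × ℝ => p.1.1 (γ' p.2) :=
    (continuous_subtype_val.comp continuous_fst).clm_apply (hγc'.comp continuous_snd)
  have hfc : ContinuousOn f {0}ᶜ := ContDiffOn.continuousOn hg
  have hF : Continuous fun p : OrthGroup d × ℝ => f (p.1.1 (γ p.2)) :=
    hfc.comp_continuous happ fun p => hγ0 _ _
  have hF' : Continuous fun p : OrthGroup d × ℝ => ⟪gradient f (p.1.1 (γ p.2)), p.1.1 (γ' p.2)⟫ :=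
    (hg.continuousOn_gradient.comp_continuous happ fun p => hγ0 _ _).inner happ'
  have hdiff : Continuous fun p : OrthGroup d × ℝ =>
      f (p.1.1 (γ (p.2 + t))) - f (p.1.1 (γ p.2)) :=
    (hF.comp (continuous_fst.prodMk (continuous_snd.add continuous_const))).sub hF
  -- For fixed `R` this is the one-dimensional inequality for `u s = f (R (γ s))`, which has period
  -- `π` because `γ (s + π) = -γ s` and `g` is even.
  have hR : ∀ R : OrthGroup d,
      ∫⁻ s in Ioc 0 Real.pi, ENNReal.ofReal ((f (R.1 (γ (s + t))) - f (R.1 (γ s))) ^ 2) ≤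
      ENNReal.ofReal (Real.sin t ^ 2) *
        ∫⁻ s in Ioc 0 Real.pi, ENNReal.ofReal (⟪gradient f (R.1 (γ s)), R.1 (γ' s)⟫ ^ 2) := by
    intro R
    have hc := Continuous.prodMk_right (Y := ℝ) R
    rw [lintegral_ofReal_intervalIntegral (f := fun s => (f (R.1 (γ (s + t))) - f (R.1 (γ s))) ^ 2)
      ((hdiff.comp hc).pow 2) (fun _ => sq_nonneg _) Real.pi_pos.le,
      lintegral_ofReal_intervalIntegral (f := fun s => ⟪gradient f (R.1 (γ s)), R.1 (γ' s)⟫ ^ 2)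
      ((hF'.comp hc).pow 2) (fun _ => sq_nonneg _) Real.pi_pos.le, ← ENNReal.ofReal_mul (sq_nonneg _)]
    refine ENNReal.ofReal_le_ofReal ?_
    refine integral_sq_translate_sub_le (u := fun s => f (R.1 (γ s))) (fun s => ?_)
      (hF'.comp hc) (fun s => ?_) t
    · have h1 : HasDerivAt (fun s => R.1 (γ s)) (R.1 (γ' s)) s :=
        R.1.hasFDerivAt.comp_hasDerivAt s (hγd s)
      have h2 := (hg.differentiableAt (hγ0 R s)).hasFDerivAt.comp_hasDerivAt s h1
      rw [← inner_gradient_eq] at h2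
      exact h2
    · have : γ (s + Real.pi) = -γ s := by
        simp only [hγ, Real.cos_add_pi, Real.sin_add_pi]; module
      simp only [this, map_neg]
      exact radialExt_neg heven _
  -- After averaging over `R`, the position `s` on the circle is immaterial. Integration over `s`
  -- then only produces a factor `π` on each side, cancelled at the end.
  have hconst1 : ∀ s, ∫⁻ R, ENNReal.ofReal ((f (R.1 (γ (s + t))) - f (R.1 (γ s))) ^ 2)
      ∂(orthMeasure d) = ∫⁻ R, ENNReal.ofReal ((f (R.1 (Real.cos t • a + Real.sin t • b)) -
        f (R.1 a)) ^ 2) ∂(orthMeasure d) := by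
    intro s
    simp only [hγadd, map_add, map_smul]
    exact lintegral_orth_pair_eq (fun x y =>
      ENNReal.ofReal ((f (Real.cos t • x + Real.sin t • y) - f x) ^ 2))
      (by rw [hγn, ha]) (by rw [hγn', hb]) (hγγ' s) hab
  have hconst2 : ∀ s, ∫⁻ R, ENNReal.ofReal (⟪gradient f (R.1 (γ s)), R.1 (γ' s)⟫ ^ 2)
      ∂(orthMeasure d) = ∫⁻ R, ENNReal.ofReal (⟪gradient f (R.1 a), R.1 b⟫ ^ 2)
      ∂(orthMeasure d) := fun s =>
    lintegral_orth_pair_eq (fun x y => ENNReal.ofReal (⟪gradient f x, y⟫ ^ 2))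
      (by rw [hγn, ha]) (by rw [hγn', hb]) (hγγ' s) hab
  have hm1 : Measurable (Function.uncurry fun (R : OrthGroup d) s =>
      ENNReal.ofReal ((f (R.1 (γ (s + t))) - f (R.1 (γ s))) ^ 2)) :=
    (hdiff.pow 2).measurable.ennreal_ofReal
  have hm2 : Measurable (Function.uncurry fun (R : OrthGroup d) s =>
      ENNReal.ofReal (⟪gradient f (R.1 (γ s)), R.1 (γ' s)⟫ ^ 2)) :=
    (hF'.pow 2).measurable.ennreal_ofReal
  have hint := lintegral_mono (μ := orthMeasure d) hR
  rw [lintegral_const_mul' _ _ ENNReal.ofReal_ne_top,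
    lintegral_lintegral_swap hm1.aemeasurable, lintegral_lintegral_swap hm2.aemeasurable] at hint
  simp only [hconst1, hconst2, lintegral_const] at hint
  rw [Measure.restrict_apply_univ, Real.volume_Ioc, sub_zero, ← mul_assoc] at hint
  have hpi : ENNReal.ofReal Real.pi ≠ 0 := by simpa using Real.pi_pos
  exact (ENNReal.mul_le_mul_iff_left hpi ENNReal.ofReal_ne_top).1 hint

/-- In the mean, a tangential derivative carries the fraction `1/(d-1)` of the gradient. -/
theorem lintegral_orth_norm_gradient_sq {d : ℕ} {g : Sph d → ℝ} (hg : SphContDiff 1 g)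
    {a b : Euc d} (ha : ‖a‖ = 1) (hb : ‖b‖ = 1) (hab : ⟪a, b⟫ = 0) :
    ∫⁻ R, ENNReal.ofReal (‖gradient (radialExt g) (R.1 a)‖ ^ 2) ∂(orthMeasure d) =
      ((d - 1 : ℕ) : ℝ≥0∞) *
        ∫⁻ R, ENNReal.ofReal (⟪gradient (radialExt g) (R.1 a), R.1 b⟫ ^ 2) ∂(orthMeasure d) := by
  set f := radialExt g with hf
  have hd : 0 < d := by
    rcases Nat.eq_zero_or_pos d with rfl | h
    · rw [Subsingleton.elim a 0, norm_zero] at ha; exact absurd ha zero_ne_one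
    · exact h
  have : NeZero d := ⟨hd.ne'⟩
  -- A basis starting with `a`: the component along `R a` is radial and vanishes, and the other `d -
  -- 1` components have equal means by transitivity on orthonormal pairs.
  obtain ⟨e, he⟩ := Orthonormal.exists_orthonormalBasis_extension_of_card_eq (𝕜 := ℝ)
    (E := Euc d) (ι := Fin d) (by simp) (v := fun _ => a) (s := {0}) (by
      rw [orthonormal_iff_ite]
      rintro ⟨i, rfl⟩ ⟨j, rfl⟩
      simp [ha])
  have he0 : e 0 = a := he 0 rfl
  have hRa : ∀ R : OrthGroup d, R.1 a ≠ 0 := fun R => by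
    rw [← norm_ne_zero_iff, norm_orth_apply, ha]; exact one_ne_zero
  have happ : ∀ x : Euc d, Continuous fun R : OrthGroup d => R.1 x := fun x =>
    continuous_subtype_val.clm_apply continuous_const
  have hG : Continuous fun R : OrthGroup d => gradient f (R.1 a) :=
    hg.continuousOn_gradient.comp_continuous (happ a) hRa
  have hsum : ∀ R : OrthGroup d, ENNReal.ofReal (‖gradient f (R.1 a)‖ ^ 2) =
      ∑ i, ENNReal.ofReal (⟪gradient f (R.1 a), R.1 (e i)⟫ ^ 2) := by
    intro R
    rw [← ENNReal.ofReal_sum_of_nonneg fun _ _ => sq_nonneg _,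
      ← (e.map (Unitary.linearIsometryEquiv R)).sum_sq_norm_inner_left (gradient f (R.1 a))]
    congr 1
    refine Finset.sum_congr rfl fun i _ => ?_
    rw [OrthonormalBasis.map_apply, Real.norm_eq_abs, sq_abs]
    rfl
  simp only [hsum]
  rw [lintegral_finsetSum (f := fun i (R : OrthGroup d) =>
      ENNReal.ofReal (⟪gradient f (R.1 a), R.1 (e i)⟫ ^ 2)) _ fun i _ =>
    ((hG.inner (happ (e i))).pow 2).measurable.ennreal_ofReal,
    ← Finset.add_sum_erase _ _ (Finset.mem_univ (0 : Fin d))]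
  have h0 : ∫⁻ R, ENNReal.ofReal (⟪gradient f (R.1 a), R.1 (e 0)⟫ ^ 2) ∂(orthMeasure d) = 0 := by
    rw [he0]
    simp [hf, hg.inner_gradient_self (hRa _)]
  rw [h0, zero_add, Finset.sum_congr rfl (g := fun _ =>
    ∫⁻ R, ENNReal.ofReal (⟪gradient f (R.1 a), R.1 b⟫ ^ 2) ∂(orthMeasure d))]
  · simp
  · intro i hi
    refine lintegral_orth_pair_eq (fun x y => ENNReal.ofReal (⟪gradient f x, y⟫ ^ 2)) rfl
      (by rw [hb, e.orthonormal.1]) ?_ hab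
    rw [← he0]
    exact e.orthonormal.2 (Finset.ne_of_mem_erase hi).symm

/-! ### The inequality for functions of class `C¹` -/

theorem sdot_mem_Icc {d : ℕ} (x σ : Sph d) : sdot x σ ∈ Icc (-1 : ℝ) 1 := by
  have h := abs_real_inner_le_norm (x : Euc d) (σ : Euc d)
  rw [norm_eq_of_mem_sphere, norm_eq_of_mem_sphere, mul_one] at h
  exact abs_le.1 h

theorem continuous_sdot {d : ℕ} : Continuous fun p : Sph d × Sph d => sdot p.1 p.2 := by
  unfold sdot; fun_prop

theorem IsCollisionKernel.beta_nonneg {d : ℕ} {β : ℝ → ℝ} {k : Sph d} (hβ : IsCollisionKernel β k)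
    (x σ : Sph d) : 0 ≤ β (sdot x σ) := hβ.nonneg _ (sdot_mem_Icc x σ)

theorem one_sub_sdot_sq_nonneg {d : ℕ} (x σ : Sph d) : 0 ≤ 1 - sdot x σ ^ 2 := by
  have h := sdot_mem_Icc x σ
  nlinarith [h.1, h.2]

/-- Averaging a double integral over the orthogonal group. -/
theorem lintegral_lintegral_surf_eq_orth {d : ℕ} {F : Sph d → Sph d → ℝ≥0∞}
    (hF : Measurable fun p : Sph d × Sph d => F p.1 p.2) :
    ∫⁻ x, ∫⁻ σ, F x σ ∂(surf d) ∂(surf d) =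
      ∫⁻ x, ∫⁻ σ, ∫⁻ R, F (orthAct R x) (orthAct R σ) ∂(orthMeasure d) ∂(surf d) ∂(surf d) := by
  have hact1 : Continuous fun p : Sph d × OrthGroup d × Sph d => orthAct p.2.1 p.1 :=
    continuous_orthAct.comp ((continuous_fst.comp continuous_snd).prodMk continuous_fst)
  have hact2 : Continuous fun p : Sph d × OrthGroup d × Sph d => orthAct p.2.1 p.2.2 :=
    continuous_orthAct.comp ((continuous_fst.comp continuous_snd).prodMk
      (continuous_snd.comp continuous_snd))
  have hF3 : Measurable fun p : Sph d × OrthGroup d × Sph d =>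
      F (orthAct p.2.1 p.1) (orthAct p.2.1 p.2.2) :=
    hF.comp (hact1.prodMk hact2).measurable
  have hF3' : Measurable fun p : (OrthGroup d × Sph d) × Sph d =>
      F (orthAct p.1.1 p.1.2) (orthAct p.1.1 p.2) :=
    hF3.comp ((measurable_snd.comp measurable_fst).prodMk
      ((measurable_fst.comp measurable_fst).prodMk measurable_snd))
  have hinner : ∀ R : OrthGroup d, ∫⁻ x, ∫⁻ σ, F (orthAct R x) (orthAct R σ) ∂(surf d) ∂(surf d) =
      ∫⁻ x, ∫⁻ σ, F x σ ∂(surf d) ∂(surf d) := by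
    intro R
    rw [← lintegral_orthAct R (fun x => ∫⁻ σ, F x σ ∂(surf d)) hF.lintegral_prod_right']
    exact lintegral_congr fun x => lintegral_orthAct R (fun σ => F (orthAct R x) σ)
      (hF.comp measurable_prodMk_left)
  calc ∫⁻ x, ∫⁻ σ, F x σ ∂(surf d) ∂(surf d)
      = ∫⁻ _R, ∫⁻ x, ∫⁻ σ, F x σ ∂(surf d) ∂(surf d) ∂(orthMeasure d) := by
        rw [lintegral_const, measure_univ, mul_one]
    _ = ∫⁻ R, ∫⁻ x, ∫⁻ σ, F (orthAct R x) (orthAct R σ) ∂(surf d) ∂(surf d)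
          ∂(orthMeasure d) := lintegral_congr fun R => (hinner R).symm
    _ = ∫⁻ x, ∫⁻ R, ∫⁻ σ, F (orthAct R x) (orthAct R σ) ∂(surf d) ∂(orthMeasure d)
          ∂(surf d) := lintegral_lintegral_swap hF3'.lintegral_prod_right'.aemeasurable
    _ = _ := lintegral_congr fun x =>
        lintegral_lintegral_swap (hF3.comp measurable_prodMk_left).aemeasurable

theorem measurable_energy_integrand {d : ℕ} {β : ℝ → ℝ} (hβ : Measurable β) {g : Sph d → ℝ}
    (hg : Continuous g) : Measurable fun p : Sph d × Sph d =>
      ENNReal.ofReal ((g p.2 - g p.1) ^ 2 * β (sdot p.1 p.2)) := by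
  refine Measurable.ennreal_ofReal (Measurable.mul (Continuous.measurable ?_)
    (hβ.comp continuous_sdot.measurable))
  fun_prop

/-- Averaging the energy over the orthogonal group. -/
theorem lintegral_gammaBeta_eq {d : ℕ} {β : ℝ → ℝ} {k : Sph d} (hβ : IsCollisionKernel β k)
    {g : Sph d → ℝ} (hg : Continuous g) :
    ∫⁻ x, gammaBeta β g x ∂(surf d) =
      2⁻¹ * ∫⁻ x, ∫⁻ σ, ENNReal.ofReal (β (sdot x σ)) *
        ∫⁻ R, ENNReal.ofReal ((g (orthAct R σ) - g (orthAct R x)) ^ 2) ∂(orthMeasure d)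
        ∂(surf d) ∂(surf d) := by
  simp only [gammaBeta]
  rw [lintegral_const_mul' _ _ (ENNReal.inv_ne_top.2 two_ne_zero),
    lintegral_lintegral_surf_eq_orth (measurable_energy_integrand hβ.measurable hg)]
  refine congrArg (2⁻¹ * ·) (lintegral_congr fun x => lintegral_congr fun σ => ?_)
  rw [← lintegral_const_mul' _ _ ENNReal.ofReal_ne_top]
  refine lintegral_congr fun R => ?_
  rw [sdot_orthAct, mul_comm, ENNReal.ofReal_mul (hβ.beta_nonneg x σ)]

/-- On `[-1, 1]` one has `1 - t² = (1 - t)(1 + t) ≤ 2 (1 - t)`. -/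
theorem IsCollisionKernel.integrable_one_sub_sq {d : ℕ} {β : ℝ → ℝ} {k : Sph d}
    (hβ : IsCollisionKernel β k) :
    Integrable (fun σ : Sph d => (1 - sdot k σ ^ 2) * β (sdot k σ)) (surf d) := by
  have hs : Continuous fun σ : Sph d => sdot k σ := continuous_sdot.comp (Continuous.prodMk_right k)
  refine (hβ.integrable.const_mul 2).mono' ?_ (Eventually.of_forall fun σ => ?_)
  · exact ((hs.measurable.pow_const 2).const_sub 1 |>.mul
      (hβ.measurable.comp hs.measurable)).aestronglyMeasurable
  · have h := sdot_mem_Icc k σ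
    have hb := hβ.beta_nonneg k σ
    rw [Real.norm_of_nonneg (mul_nonneg (one_sub_sdot_sq_nonneg k σ) hb), ← mul_assoc]
    exact mul_le_mul_of_nonneg_right (by nlinarith [h.1, h.2]) hb

theorem lintegral_one_sub_sdot_sq_mul {d : ℕ} (hd : 2 ≤ d) {β : ℝ → ℝ} {k : Sph d}
    (hβ : IsCollisionKernel β k) (x : Sph d) :
    ∫⁻ σ, ENNReal.ofReal (β (sdot x σ)) * ENNReal.ofReal (1 - sdot x σ ^ 2) ∂(surf d) =
      2 * ((d - 1 : ℕ) : ℝ≥0∞) * ENNReal.ofReal (sigmaBeta β k) := by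
  have h1 : (0 : ℝ) < (d : ℝ) - 1 := by
    have : (2 : ℝ) ≤ d := by exact_mod_cast hd
    linarith
  rw [lintegral_comp_sdot (f := fun t => ENNReal.ofReal (β t) * ENNReal.ofReal (1 - t ^ 2))
    (hβ.measurable.ennreal_ofReal.mul (by fun_prop)) x k]
  have : ∀ σ : Sph d, ENNReal.ofReal (β (sdot k σ)) * ENNReal.ofReal (1 - sdot k σ ^ 2) =
      ENNReal.ofReal ((1 - sdot k σ ^ 2) * β (sdot k σ)) := fun σ => by
    rw [ENNReal.ofReal_mul (one_sub_sdot_sq_nonneg k σ), mul_comm]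
  simp only [this]
  rw [← ofReal_integral_eq_lintegral_ofReal hβ.integrable_one_sub_sq
    (Eventually.of_forall fun σ => mul_nonneg (one_sub_sdot_sq_nonneg k σ) (hβ.beta_nonneg k σ)),
    sigmaBeta]
  have e : (2 : ℝ≥0∞) * ((d - 1 : ℕ) : ℝ≥0∞) = ENNReal.ofReal (2 * ((d : ℝ) - 1)) := by
    rw [ENNReal.ofReal_mul zero_le_two, ← ENNReal.ofReal_natCast, Nat.cast_sub (by omega)]
    simp
  rw [e, ← ENNReal.ofReal_mul (by positivity)]
  congr 1
  field_simp

theorem exists_orthonormal_pair {d : ℕ} (hd : 2 ≤ d) :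
    ∃ a b : Euc d, ‖a‖ = 1 ∧ ‖b‖ = 1 ∧ ⟪a, b⟫ = 0 := by
  refine ⟨EuclideanSpace.single ⟨0, by omega⟩ 1, EuclideanSpace.single ⟨1, by omega⟩ 1, ?_, ?_, ?_⟩
  · simp
  · simp
  · simp [EuclideanSpace.inner_single_left]

theorem lintegral_norm_sphGrad_sq {d : ℕ} {g : Sph d → ℝ} (hg : SphContDiff 1 g)
    {a b : Euc d} (ha : ‖a‖ = 1) (hb : ‖b‖ = 1) (hab : ⟪a, b⟫ = 0) :
    ∫⁻ x, ENNReal.ofReal (‖sphGrad g x‖ ^ 2) ∂(surf d) =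
      surf d univ * (((d - 1 : ℕ) : ℝ≥0∞) *
        ∫⁻ R, ENNReal.ofReal (⟪gradient (radialExt g) (R.1 a), R.1 b⟫ ^ 2) ∂(orthMeasure d)) := by
  have hm : Measurable fun x => ENNReal.ofReal (‖sphGrad g x‖ ^ 2) :=
    (hg.continuous_sphGrad.norm.pow 2).measurable.ennreal_ofReal
  rw [lintegral_surf_eq_lintegral_orth hm
    ⟨a, by rw [mem_sphere_zero_iff_norm, ha]⟩, ← lintegral_orth_norm_gradient_sq hg ha hb hab]
  rfl

/-- The kernel contributes `2 (d-1) Σ(β)` and the gradient identity `d - 1`, so the constants match.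
This reduces both the inequality and the equality case to a comparison for each pair `(x, σ)`. -/
theorem kernel_mul_energy_eq {d : ℕ} (hd : 2 ≤ d) {β : ℝ → ℝ} {k : Sph d}
    (hβ : IsCollisionKernel β k) {g : Sph d → ℝ} (hg : SphContDiff 1 g)
    {a b : Euc d} (ha : ‖a‖ = 1) (hb : ‖b‖ = 1) (hab : ⟪a, b⟫ = 0) :
    2⁻¹ * ∫⁻ x, ∫⁻ σ, ENNReal.ofReal (β (sdot x σ)) * (ENNReal.ofReal (1 - sdot x σ ^ 2) *
        ∫⁻ R, ENNReal.ofReal (⟪gradient (radialExt g) (R.1 a), R.1 b⟫ ^ 2) ∂(orthMeasure d))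
        ∂(surf d) ∂(surf d) =
      ENNReal.ofReal (sigmaBeta β k) * ∫⁻ x, ENNReal.ofReal (‖sphGrad g x‖ ^ 2) ∂(surf d) := by
  rw [lintegral_norm_sphGrad_sq hg ha hb hab]
  set D := ∫⁻ R, ENNReal.ofReal (⟪gradient (radialExt g) (R.1 a), R.1 b⟫ ^ 2) ∂(orthMeasure d)
  have hx : ∀ x : Sph d, ∫⁻ σ, ENNReal.ofReal (β (sdot x σ)) * (ENNReal.ofReal (1 - sdot x σ ^ 2) *
      D) ∂(surf d) = 2 * ((d - 1 : ℕ) : ℝ≥0∞) * ENNReal.ofReal (sigmaBeta β k) * D := by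
    intro x
    have hs : Continuous fun σ : Sph d => sdot x σ :=
      continuous_sdot.comp (Continuous.prodMk_right x)
    simp only [← mul_assoc]
    have hm : Measurable fun σ : Sph d =>
        ENNReal.ofReal (β (sdot x σ)) * ENNReal.ofReal (1 - sdot x σ ^ 2) :=
      (hβ.measurable.comp hs.measurable).ennreal_ofReal.mul
        (Continuous.measurable (by fun_prop)).ennreal_ofReal
    rw [lintegral_mul_const _ hm, lintegral_one_sub_sdot_sq_mul hd hβ x]
  simp only [hx, lintegral_const]
  have h2 : (2⁻¹ : ℝ≥0∞) * 2 = 1 := ENNReal.inv_mul_cancel two_ne_zero ENNReal.ofNat_ne_top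
  calc _ = (2⁻¹ * 2) * (ENNReal.ofReal (sigmaBeta β k) *
        (surf d univ * (((d - 1 : ℕ) : ℝ≥0∞) * D))) := by ring
    _ = _ := by rw [h2, one_mul]

/-- The inequality for functions of class `C¹`. -/
theorem lintegral_gammaBeta_le {d : ℕ} (hd : 2 ≤ d) {β : ℝ → ℝ} {k : Sph d}
    (hβ : IsCollisionKernel β k) {g : Sph d → ℝ} (hg : SphContDiff 1 g)
    (heven : ∀ σ, g (-σ) = g σ) :
    ∫⁻ x, gammaBeta β g x ∂(surf d) ≤
      ENNReal.ofReal (sigmaBeta β k) * ∫⁻ x, ENNReal.ofReal (‖sphGrad g x‖ ^ 2) ∂(surf d) := by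
  obtain ⟨a, b, ha, hb, hab⟩ := exists_orthonormal_pair hd
  rw [lintegral_gammaBeta_eq hβ hg.continuous, ← kernel_mul_energy_eq hd hβ hg ha hb hab]
  refine mul_le_mul_right (lintegral_mono fun x => lintegral_mono fun σ =>
    mul_le_mul_right ?_ _) _
  set t := sdot x σ with ht
  have htI := sdot_mem_Icc x σ
  have hx := norm_eq_of_mem_sphere x
  have hσ := norm_eq_of_mem_sphere σ
  have hxx : ⟪(x : Euc d), (x : Euc d)⟫ = 1 := by rw [real_inner_self_eq_norm_sq, hx, one_pow]
  have hnorm : ‖(σ : Euc d) - t • (x : Euc d)‖ ^ 2 = 1 - t ^ 2 := by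
    rw [norm_sub_sq_real, norm_smul, inner_smul_right, hσ, hx, real_inner_comm,
      show ⟪(x : Euc d), (σ : Euc d)⟫ = t from rfl, mul_one, Real.norm_eq_abs, sq_abs]
    ring
  have hsqrt : ‖(σ : Euc d) - t • (x : Euc d)‖ = √(1 - t ^ 2) := by
    rw [← hnorm, Real.sqrt_sq (norm_nonneg _)]
  -- If `σ = ± x` no great circle is singled out, but the increment vanishes, at the antipode
  -- because `g` is even.
  rcases (one_sub_sdot_sq_nonneg x σ).eq_or_lt with h0 | hpos
  · have hz : (σ : Euc d) = t • (x : Euc d) := by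
      rw [← ht] at h0
      rw [← h0, sq_eq_zero_iff, norm_eq_zero, sub_eq_zero] at hnorm
      exact hnorm
    have hσx : σ = x ∨ σ = -x := by
      have : t = 1 ∨ t = -1 := sq_eq_one_iff.1 (by linarith)
      rcases this with h | h
      · left; ext1; rw [hz, h, one_smul]
      · right; ext1; rw [hz, h, neg_smul, one_smul]; rfl
    have hzero : ∀ R : OrthGroup d, g (orthAct R σ) - g (orthAct R x) = 0 := by
      intro R
      rcases hσx with rfl | rfl
      · exact sub_self _
      · have : orthAct R (-x) = -orthAct R x := Subtype.ext (map_neg R.1 (x : Euc d))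
        rw [this, heven, sub_self]
    simp [hzero]
  · rw [← ht] at hpos
    set s := √(1 - t ^ 2) with hs
    have hspos : 0 < s := Real.sqrt_pos.2 hpos
    -- Gram–Schmidt: `σ` lies on the great circle issued from `x` in direction `e`, at arc length
    -- `arccos t`.
    set e : Euc d := s⁻¹ • ((σ : Euc d) - t • (x : Euc d)) with he
    have hen : ‖e‖ = 1 := by
      rw [he, norm_smul, hsqrt, norm_inv, Real.norm_of_nonneg hspos.le, inv_mul_cancel₀ hspos.ne']
    have hxe : ⟪(x : Euc d), e⟫ = 0 := by
      rw [he, inner_smul_right, inner_sub_right, inner_smul_right, hxx,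
        show ⟪(x : Euc d), (σ : Euc d)⟫ = t from rfl]
      simp
    have hσe : (σ : Euc d) = Real.cos (Real.arccos t) • (x : Euc d) +
        Real.sin (Real.arccos t) • e := by
      rw [Real.cos_arccos htI.1 htI.2, Real.sin_arccos, ← hs, he, smul_smul,
        mul_inv_cancel₀ hspos.ne', one_smul]
      abel
    have hsin : Real.sin (Real.arccos t) ^ 2 = 1 - t ^ 2 := by
      rw [Real.sin_arccos, Real.sq_sqrt hpos.le]
    have key := lintegral_orth_sq_sub_le hg heven hx hen hxe (Real.arccos t)
    rw [← hσe, hsin, lintegral_orth_pair_eq (fun x y =>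
      ENNReal.ofReal (⟪gradient (radialExt g) x, y⟫ ^ 2)) (hx.trans ha.symm) (hen.trans hb.symm)
      hxe hab] at key
    refine le_trans (le_of_eq (lintegral_congr fun R => ?_)) key
    rw [← coe_orthAct, ← coe_orthAct, radialExt_coe, radialExt_coe]

/-! ### Restrictions to the sphere and the divergence theorem -/

theorem sphContDiff_of_contDiff {d : ℕ} {n : ℕ∞} {g : Sph d → ℝ} {F : Euc d → ℝ}
    (hF : ContDiff ℝ n F) (hg : ∀ σ : Sph d, g σ = F σ) : SphContDiff n g := by
  have h0 : ContDiffOn ℝ n (fun x : Euc d => ‖x‖⁻¹) {0}ᶜ :=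
    ContDiffOn.inv (fun x hx => (contDiffAt_norm ℝ hx).contDiffWithinAt)
      fun x hx => norm_ne_zero_iff.2 hx
  have h1 : ContDiffOn ℝ n (fun x : Euc d => ‖x‖⁻¹ • x) {0}ᶜ := h0.smul contDiffOn_id
  refine (hF.comp_contDiffOn h1).congr fun x hx => ?_
  have hx0 : x ≠ 0 := hx
  rw [radialExt, dif_neg hx0, hg]
  rfl

/-- The two functions agree only on the sphere, so they are compared along a great circle with
velocity `v`, after reduction to unit `v`. -/
theorem inner_sphGrad_eq_fderiv {d : ℕ} {g : Sph d → ℝ} {F : Euc d → ℝ}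
    (hgs : SphContDiff 1 g) (hF : Differentiable ℝ F) (hg : ∀ σ : Sph d, g σ = F σ) (σ : Sph d)
    {v : Euc d} (hv : ⟪(σ : Euc d), v⟫ = 0) : ⟪sphGrad g σ, v⟫ = fderiv ℝ F σ v := by
  rw [sphGrad, inner_gradient_eq]
  have hσ := norm_eq_of_mem_sphere σ
  suffices h : ∀ w : Euc d, ‖w‖ = 1 → ⟪(σ : Euc d), w⟫ = 0 →
      fderiv ℝ (radialExt g) σ w = fderiv ℝ F σ w by
    rcases eq_or_ne v 0 with rfl | hv0
    · simp
    · obtain ⟨w, hw⟩ := exists_eq_smul_coe hv0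
      have hn : ‖v‖ ≠ 0 := norm_ne_zero_iff.2 hv0
      rw [hw, inner_smul_right, mul_eq_zero, or_iff_right hn] at hv
      rw [hw, map_smul, map_smul, h w (norm_eq_of_mem_sphere w) hv]
  intro w hw hσw
  have hγ : HasDerivAt (fun s : ℝ => Real.cos s • (σ : Euc d) + Real.sin s • w) w 0 := by
    have := ((Real.hasDerivAt_cos 0).smul_const (σ : Euc d)).add
      ((Real.hasDerivAt_sin 0).smul_const w)
    exact this.congr_deriv (by simp)
  have h0 : Real.cos 0 • (σ : Euc d) + Real.sin 0 • w = σ := by simp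
  have h1 : HasDerivAt (fun s : ℝ => radialExt g (Real.cos s • (σ : Euc d) + Real.sin s • w))
      (fderiv ℝ (radialExt g) σ w) 0 := by
    have h' : HasFDerivAt (radialExt g) (fderiv ℝ (radialExt g) σ)
        (Real.cos 0 • (σ : Euc d) + Real.sin 0 • w) := by
      rw [h0]; exact (hgs.differentiableAt (coe_sph_ne_zero σ)).hasFDerivAt
    exact h'.comp_hasDerivAt 0 hγ
  have h2 : HasDerivAt (fun s : ℝ => F (Real.cos s • (σ : Euc d) + Real.sin s • w))
      (fderiv ℝ F σ w) 0 := by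
    have h' : HasFDerivAt F (fderiv ℝ F σ) (Real.cos 0 • (σ : Euc d) + Real.sin 0 • w) := by
      rw [h0]; exact (hF _).hasFDerivAt
    exact h'.comp_hasDerivAt 0 hγ
  have h3 : (fun s : ℝ => radialExt g (Real.cos s • (σ : Euc d) + Real.sin s • w)) =
      fun s => F (Real.cos s • (σ : Euc d) + Real.sin s • w) := by
    funext s
    have hm : Real.cos s • (σ : Euc d) + Real.sin s • w ∈ Metric.sphere (0 : Euc d) 1 := by
      rw [mem_sphere_zero_iff_norm]; exact norm_cos_smul_add_sin_smul hσ hw hσw s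
    have := radialExt_coe g ⟨_, hm⟩
    rw [this, hg]
  rw [h3] at h1
  exact h1.unique h2

theorem trace_eq_sum_coord {d : ℕ} (T : Euc d →ₗ[ℝ] Euc d) :
    LinearMap.trace ℝ (Euc d) T = ∑ i, (T (EuclideanSpace.basisFun (Fin d) ℝ i)) i := by
  rw [LinearMap.trace_eq_sum_inner T (EuclideanSpace.basisFun (Fin d) ℝ)]
  refine Finset.sum_congr rfl fun i _ => ?_
  rw [EuclideanSpace.basisFun_apply, EuclideanSpace.inner_single_left]
  simp

/-- The extra term in the differential has rank one, with trace `dψ (X)`; tangency of `X` removes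
its radial correction. -/
theorem sphDiv_smul {d : ℕ} {ψ : Euc d → ℝ} {X : Euc d → Euc d} (σ : Sph d)
    (hψ : DifferentiableAt ℝ ψ σ) (hX : DifferentiableAt ℝ X σ)
    (ht : ⟪X σ, (σ : Euc d)⟫ = 0) :
    sphDiv (fun x => ψ x • X x) σ = fderiv ℝ ψ σ (X σ) + ψ σ * sphDiv X σ := by
  have h : fderiv ℝ (fun x => ψ x • X x) (σ : Euc d) =
      ψ σ • fderiv ℝ X σ + (fderiv ℝ ψ σ).smulRight (X σ) := fderiv_fun_smul hψ hX
  have htr : LinearMap.trace ℝ (Euc d)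
      (((fderiv ℝ ψ (σ : Euc d)).smulRight (X σ) : Euc d →L[ℝ] Euc d) : Euc d →ₗ[ℝ] Euc d) =
      fderiv ℝ ψ σ (X σ) := by
    rw [trace_eq_sum_coord]
    conv_rhs => rw [← (EuclideanSpace.basisFun (Fin d) ℝ).sum_repr (X σ), map_sum]
    refine Finset.sum_congr rfl fun i _ => ?_
    simp [mul_comm]
  rw [sphDiv, sphDiv, h, ContinuousLinearMap.toLinearMap_add, map_add,
    ContinuousLinearMap.toLinearMap_smul, map_smul, htr]
  simp only [add_apply, smul_apply,
    ContinuousLinearMap.smulRight_apply, inner_add_left, inner_smul_left, ht]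
  simp
  ring

theorem sphDiv_skew {d : ℕ} {A : Euc d →L[ℝ] Euc d} (hA : ∀ x, ⟪A x, x⟫ = 0) (σ : Sph d) :
    sphDiv A σ = 0 := by
  rw [sphDiv, ContinuousLinearMap.fderiv, hA, sub_zero,
    LinearMap.trace_eq_sum_inner _ (EuclideanSpace.basisFun (Fin d) ℝ)]
  refine Finset.sum_eq_zero fun i _ => ?_
  rw [real_inner_comm]
  exact hA _

theorem exp_smul_mem_unitary {d : ℕ} {A : Euc d →L[ℝ] Euc d} (hA : ∀ x, ⟪A x, x⟫ = 0) (t : ℝ) :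
    NormedSpace.exp (t • A) ∈ unitary (Euc d →L[ℝ] Euc d) := by
  let : NormedAlgebra ℚ (Euc d →L[ℝ] Euc d) := NormedAlgebra.restrictScalars ℚ ℝ _
  refine NormedSpace.exp_mem_unitary_of_mem_skewAdjoint ?_
  refine skewAdjoint.smul_mem t ?_
  rw [skewAdjoint.mem_iff]
  have hskew : ∀ x y, ⟪A x, y⟫ = -⟪A y, x⟫ := fun x y => by
    have h := hA (x + y)
    rw [map_add, inner_add_left, inner_add_right, inner_add_right, hA, hA] at h
    linarith
  ext1 x
  refine ext_inner_right ℝ fun y => ?_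
  rw [ContinuousLinearMap.star_eq_adjoint, ContinuousLinearMap.adjoint_inner_left,
    neg_apply, inner_neg_left, real_inner_comm, hskew]

theorem integral_orthAct {d : ℕ} (R : OrthGroup d) {h : Sph d → ℝ}
    (hh : AEStronglyMeasurable h (surf d)) :
    ∫ x, h (orthAct R x) ∂(surf d) = ∫ x, h x ∂(surf d) := by
  have hm := measurePreserving_orthAct R
  conv_rhs => rw [← hm.map_eq]
  rw [integral_map hm.measurable.aemeasurable (by rwa [hm.map_eq])]

theorem Continuous.integrable_surf {d : ℕ} {E : Type*} [NormedAddCommGroup E] {h : Sph d → E}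
    (hh : Continuous h) : Integrable h (surf d) := by
  rw [← integrableOn_univ]
  exact hh.continuousOn.integrableOn_compact isCompact_univ

/-- Derivatives along infinitesimal rotations integrate to zero over the sphere. -/
theorem integral_fderiv_skew {d : ℕ} {A : Euc d →L[ℝ] Euc d} (hA : ∀ x, ⟪A x, x⟫ = 0)
    {ψ : Euc d → ℝ} (hψ : ContDiff ℝ 1 ψ) :
    ∫ σ : Sph d, fderiv ℝ ψ σ (A σ) ∂(surf d) = 0 := by
  set U : ℝ → OrthGroup d := fun t => ⟨NormedSpace.exp (t • A), exp_smul_mem_unitary hA t⟩ with hU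
  have hψ' : Continuous fun y : Euc d => fderiv ℝ ψ y (A y) :=
    (hψ.continuous_fderiv (by simp)).clm_apply A.continuous
  have hder : ∀ (σ : Sph d) (t : ℝ), HasDerivAt (fun t => ψ (orthAct (U t) σ))
      (fderiv ℝ ψ (orthAct (U t) σ) (A (orthAct (U t) σ))) t := by
    intro σ t
    have h1 : HasDerivAt (fun t : ℝ => NormedSpace.exp (t • A)) (A * NormedSpace.exp (t • A)) t :=
      hasDerivAt_exp_smul_const' A t
    have h2 := h1.clm_apply (hasDerivAt_const t (σ : Euc d))
    have h3 := (hψ.differentiable (by simp) (orthAct (U t) σ : Euc d)).hasFDerivAt.comp_hasDerivAt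
      t h2
    exact h3.congr_deriv (by simp [hU])
  obtain ⟨C, hC⟩ := (isCompact_sphere (0 : Euc d) 1).exists_bound_of_continuousOn hψ'.continuousOn
  have hd := hasDerivAt_integral_of_dominated_loc_of_deriv_le (μ := surf d) (s := univ)
    (bound := fun _ => C) (F := fun t (σ : Sph d) => ψ (orthAct (U t) σ))
    (F' := fun t σ => fderiv ℝ ψ (orthAct (U t) σ) (A (orthAct (U t) σ))) (x₀ := 0)
    univ_mem (Eventually.of_forall fun t => ?_) ?_ ?_
    (Eventually.of_forall fun σ t _ => hC _ (orthAct (U t) σ).2) (integrable_const C)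
    (Eventually.of_forall fun σ t _ => hder σ t)
  -- By rotation invariance the integral of `ψ (e^{tA} σ)` is constant in `t`; its derivative at
  -- `0`, taken under the integral, is the one in question.
  · have hconst : (fun t => ∫ σ : Sph d, ψ (orthAct (U t) σ) ∂(surf d)) =
        fun _ => ∫ σ : Sph d, ψ σ ∂(surf d) := funext fun t =>
      integral_orthAct (U t) (hψ.continuous.comp continuous_subtype_val).aestronglyMeasurable
    rw [hconst] at hd
    have h0 := hd.2.unique (hasDerivAt_const (0 : ℝ) _)
    have hexp : NormedSpace.exp ((0 : ℝ) • A) = 1 := by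
      rw [zero_smul ℝ A, NormedSpace.exp_zero]
    have hU0 : ∀ σ, orthAct (U 0) σ = σ := fun σ =>
      Subtype.ext (congrArg (fun B : Euc d →L[ℝ] Euc d => B σ) hexp)
    simpa only [hU0] using h0
  · exact (hψ.continuous.comp (continuous_subtype_val.comp
      (continuous_orthAct.comp (Continuous.prodMk_right _)))).aestronglyMeasurable
  · exact (hψ.continuous.comp (continuous_subtype_val.comp
      (continuous_orthAct.comp (Continuous.prodMk_right _)))).integrable_surf
  · exact (hψ'.comp (continuous_subtype_val.comp
      (continuous_orthAct.comp (Continuous.prodMk_right _)))).aestronglyMeasurable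

/-- The generator `x ↦ ⟪u, x⟫ v - ⟪v, x⟫ u` of the rotations in the plane spanned by `u`, `v`. -/
noncomputable def rotGen {d : ℕ} (u v : Euc d) : Euc d →L[ℝ] Euc d :=
  (innerSL ℝ u).smulRight v - (innerSL ℝ v).smulRight u

theorem rotGen_apply {d : ℕ} (u v x : Euc d) : rotGen u v x = ⟪u, x⟫ • v - ⟪v, x⟫ • u := rfl

theorem inner_rotGen_self {d : ℕ} (u v x : Euc d) : ⟪rotGen u v x, x⟫ = 0 := by
  rw [rotGen_apply, inner_sub_left, inner_smul_left, inner_smul_left]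
  simp
  ring

/-- The divergence theorem on the sphere. -/
theorem integral_sphDiv_eq_zero {d : ℕ} {Y : Euc d → Euc d} (hY : ContDiff ℝ 1 Y)
    (ht : ∀ σ : Sph d, ⟪Y σ, (σ : Euc d)⟫ = 0) : ∫ σ, sphDiv Y σ ∂(surf d) = 0 := by
  set e : Fin d → Euc d := fun i => EuclideanSpace.basisFun (Fin d) ℝ i with he
  have hei : ∀ i (x : Euc d), ⟪e i, x⟫ = x i := fun i x => by
    simp [he, EuclideanSpace.inner_single_left]
  set ψ : Fin d → Fin d → Euc d → ℝ := fun i j x => Y x j * x i with hψ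
  have hcoord : ∀ i, ContDiff ℝ 1 fun x : Euc d => x i := fun i =>
    (EuclideanSpace.proj (𝕜 := ℝ) i : Euc d →L[ℝ] ℝ).contDiff
  have hψc : ∀ i j, ContDiff ℝ 1 (ψ i j) := fun i j =>
    ((hcoord j).comp hY).mul (hcoord i)
  have hψd : ∀ i j (x w : Euc d), fderiv ℝ (ψ i j) x w = Y x j * w i + x i * (fderiv ℝ Y x w) j := by
    intro i j x w
    have h1 : HasFDerivAt (fun x : Euc d => x i) (EuclideanSpace.proj (𝕜 := ℝ) i : Euc d →L[ℝ] ℝ) x :=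
      (EuclideanSpace.proj (𝕜 := ℝ) i : Euc d →L[ℝ] ℝ).hasFDerivAt
    have h2 : HasFDerivAt (fun x : Euc d => Y x j)
        ((EuclideanSpace.proj (𝕜 := ℝ) j : Euc d →L[ℝ] ℝ).comp (fderiv ℝ Y x)) x :=
      (EuclideanSpace.proj (𝕜 := ℝ) j : Euc d →L[ℝ] ℝ).hasFDerivAt.comp x
        (hY.differentiable (by simp) x).hasFDerivAt
    have h3 : HasFDerivAt (ψ i j) _ x := h2.mul h1
    rw [h3.fderiv]
    simp
  -- With `L_ij = x_i ∂_j - x_j ∂_i` one has `div Y = ∑ L_ij (x_i Y_j)` on the sphere, using `|x| =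
  -- 1` and `x·Y = 0`. Each term is a derivative along a rotation and so has integral zero.
  have key : ∀ σ : Sph d, sphDiv Y σ =
      ∑ i, ∑ j, fderiv ℝ (ψ i j) σ (rotGen (e i) (e j) σ) := by
    intro σ
    set x : Euc d := (σ : Euc d) with hx
    set M : Fin d → Fin d → ℝ := fun i j => (fderiv ℝ Y x (e i)) j with hM
    have hnorm : ∑ i, x i * x i = 1 := by
      have := norm_eq_of_mem_sphere σ
      rw [← hx, EuclideanSpace.norm_eq, Real.sqrt_eq_one] at this
      simpa [sq] using this
    have htan : ∑ i, Y x i * x i = 0 := by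
      have := ht σ
      rw [← hx, PiLp.inner_apply] at this
      simpa [mul_comm] using this
    have hDx : ∀ j, (fderiv ℝ Y x x) j = ∑ i, x i * M i j := by
      intro j
      have hw : ∀ w : Euc d, (fderiv ℝ Y x w) j = ∑ i, w i * M i j := by
        intro w
        have hws : w = ∑ i, w i • e i := ((EuclideanSpace.basisFun (Fin d) ℝ).sum_repr w).symm
        conv_lhs => rw [hws, map_sum]
        rw [WithLp.ofLp_sum, Finset.sum_apply]
        refine Finset.sum_congr rfl fun i _ => ?_
        rw [map_smul]
        rfl
      exact hw x
    have hsd : sphDiv Y σ = ∑ i, M i i - ∑ j, (∑ i, x i * M i j) * x j := by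
      rw [sphDiv, trace_eq_sum_coord, ← hx, PiLp.inner_apply]
      simp only [← hDx]
      congr 1
      simp [mul_comm]
    have hterm : ∀ i j, fderiv ℝ (ψ i j) x (rotGen (e i) (e j) x) =
        Y x j * (x i * (e j) i) - Y x j * x j * (e i) i + (x i * x i * M j j - x i * x j * M i j) := by
      intro i j
      rw [hψd, rotGen_apply, hei, hei, map_sub, map_smul, map_smul]
      simp [hM]
      ring
    have hδ : ∀ i j, (e j) i = if i = j then 1 else 0 := fun i j => by
      simp [he]
    have hsw : ∑ i, ∑ j, x i * x j * M i j = ∑ j, (∑ i, x i * M i j) * x j := by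
      rw [Finset.sum_comm]
      refine Finset.sum_congr rfl fun j _ => ?_
      rw [Finset.sum_mul]
      exact Finset.sum_congr rfl fun i _ => by ring
    have hmul : ∑ i, ∑ j, x i * x i * M j j = ∑ j, M j j := by
      simp only [← Finset.mul_sum]
      rw [← Finset.sum_mul, hnorm, one_mul]
    simp only [hterm, Finset.sum_add_distrib, Finset.sum_sub_distrib]
    rw [hsw, hmul, hsd]
    simp [hδ, htan]
  have hint : ∀ i j, Integrable
      (fun σ : Sph d => fderiv ℝ (ψ i j) σ (rotGen (e i) (e j) σ)) (surf d) := fun i j => by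
    have h : Continuous fun y : Euc d => fderiv ℝ (ψ i j) y (rotGen (e i) (e j) y) :=
      ((hψc i j).continuous_fderiv (by simp)).clm_apply (rotGen (e i) (e j)).continuous
    exact (h.comp continuous_subtype_val).integrable_surf
  simp only [key]
  rw [integral_finsetSum]
  · refine Finset.sum_eq_zero fun i _ => ?_
    rw [integral_finsetSum]
    · exact Finset.sum_eq_zero fun j _ => integral_fderiv_skew (inner_rotGen_self _ _) (hψc i j)
    · exact fun j _ => hint i j
  · exact fun i _ => integrable_finsetSum _ fun j _ => hint i j

theorem Continuous.memLp_surf {d : ℕ} {E : Type*} [NormedAddCommGroup E] {h : Sph d → E}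
    (hh : Continuous h) : MemLp h 2 (surf d) := by
  obtain ⟨C, hC⟩ := isCompact_univ.exists_bound_of_continuousOn hh.continuousOn
  exact MemLp.of_bound hh.aestronglyMeasurable C (Eventually.of_forall fun x => hC x (mem_univ x))

/-- The gradient of the restriction of a smooth function is its weak gradient. -/
theorem hasWeakGrad_sphGrad {d : ℕ} {g : Sph d → ℝ} {F : Euc d → ℝ} (hF : ContDiff ℝ 1 F)
    (hg : ∀ σ : Sph d, g σ = F σ) : HasWeakGrad g (sphGrad g) := by
  have hgs : SphContDiff 1 g := sphContDiff_of_contDiff (by exact_mod_cast hF) hg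
  have hFd := hF.differentiable (by simp)
  refine ⟨hgs.continuous.memLp_surf, hgs.continuous_sphGrad.memLp_surf,
    Eventually.of_forall fun σ => hgs.inner_gradient_self (coe_sph_ne_zero σ), fun X hX ht => ?_⟩
  have hX1 : ContDiff ℝ 1 X := hX.of_le (by exact_mod_cast le_top)
  have hXd := hX1.differentiable (by simp)
  -- The divergence theorem for `F X`, expanded by the product rule, is the integration by parts
  -- defining the weak gradient.
  have hdiv := integral_sphDiv_eq_zero (Y := fun x => F x • X x) (hF.smul hX1) fun σ => by
    rw [inner_smul_left, ht, mul_zero]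
  have hpt : ∀ σ : Sph d, sphDiv (fun x => F x • X x) σ =
      ⟪sphGrad g σ, X σ⟫ + g σ * sphDiv X σ := fun σ => by
    rw [sphDiv_smul σ (hFd _) (hXd _) (ht σ),
      inner_sphGrad_eq_fderiv hgs hFd hg σ (by rw [real_inner_comm]; exact ht σ), hg]
  have hsd : Continuous fun σ : Sph d => sphDiv X σ := by
    have h := hX1.continuous_fderiv (by simp)
    have h' : ∀ v : Euc d, Continuous fun σ : Sph d => fderiv ℝ X σ v := fun v =>
      (h.comp continuous_subtype_val).clm_apply continuous_const
    unfold sphDiv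
    refine Continuous.sub ?_ (((h.comp continuous_subtype_val).clm_apply
      continuous_subtype_val).inner continuous_subtype_val)
    simp only [trace_eq_sum_coord]
    refine continuous_finsetSum _ fun i _ => ?_
    exact (EuclideanSpace.proj (𝕜 := ℝ) i : Euc d →L[ℝ] ℝ).continuous.comp (h' _)
  simp only [hpt] at hdiv
  rw [integral_add] at hdiv
  · linarith
  · exact (hgs.continuous_sphGrad.inner (hX1.continuous.comp continuous_subtype_val)).integrable_surf
  · exact (hgs.continuous.mul hsd).integrable_surf

/-! ### Sharpness: products of two coordinates -/

/-- The inequality is an equality for products of two coordinates. -/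
theorem lintegral_gammaBeta_inner_mul_inner {d : ℕ} (hd : 2 ≤ d) {β : ℝ → ℝ} {k : Sph d}
    (hβ : IsCollisionKernel β k) (p q : Euc d) {g : Sph d → ℝ}
    (hg : ∀ σ : Sph d, g σ = ⟪p, (σ : Euc d)⟫ * ⟪q, (σ : Euc d)⟫) :
    ∫⁻ x, gammaBeta β g x ∂(surf d) =
      ENNReal.ofReal (sigmaBeta β k) * ∫⁻ x, ENNReal.ofReal (‖sphGrad g x‖ ^ 2) ∂(surf d) := by
  obtain ⟨a, b, ha, hb, hab⟩ := exists_orthonormal_pair hd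
  have hF : ContDiff ℝ 1 fun x : Euc d => ⟪p, x⟫ * ⟪q, x⟫ :=
    (innerSL ℝ p).contDiff.mul (innerSL ℝ q).contDiff
  have hgs : SphContDiff 1 g := sphContDiff_of_contDiff (by exact_mod_cast hF) hg
  have hFd : ∀ x v : Euc d, fderiv ℝ (fun x : Euc d => ⟪p, x⟫ * ⟪q, x⟫) x v =
      ⟪p, x⟫ * ⟪q, v⟫ + ⟪q, x⟫ * ⟪p, v⟫ := by
    intro x v
    have h : HasFDerivAt (fun x : Euc d => ⟪p, x⟫ * ⟪q, x⟫) _ x :=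
      (innerSL ℝ p).hasFDerivAt.mul (innerSL ℝ q).hasFDerivAt
    rw [h.fderiv]
    simp
  rw [lintegral_gammaBeta_eq hβ hgs.continuous, ← kernel_mul_energy_eq hd hβ hgs ha hb hab]
  refine congrArg (2⁻¹ * ·) (lintegral_congr fun x => lintegral_congr fun σ =>
    congrArg (_ * ·) ?_)
  set t := sdot x σ with ht
  have htI := sdot_mem_Icc x σ
  rw [← ht] at htI
  have hx := norm_eq_of_mem_sphere x
  have hσ := norm_eq_of_mem_sphere σ
  have hxσ : ⟪(x : Euc d), (σ : Euc d)⟫ = t := rfl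
  have hadd : ‖(σ : Euc d) + x‖ ^ 2 = 2 + 2 * t := by
    rw [norm_add_sq_real, hσ, hx, real_inner_comm, hxσ]; ring
  have hsub : ‖(σ : Euc d) - x‖ ^ 2 = 2 - 2 * t := by
    rw [norm_sub_sq_real, hσ, hx, real_inner_comm, hxσ]; ring
  have hperp : ⟪(σ : Euc d) + x, (σ : Euc d) - x⟫ = 0 := by
    rw [inner_add_left, inner_sub_right, inner_sub_right, real_inner_self_eq_norm_sq,
      real_inner_self_eq_norm_sq, hσ, hx, real_inner_comm]; ring
  -- Polarization expresses the increment by the symmetric bilinear form at `σ + x` and `σ - x`,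
  -- which are orthogonal since `|σ| = |x|`.
  have hpol : ∀ R : OrthGroup d, g (orthAct R σ) - g (orthAct R x) =
      2⁻¹ * (⟪p, R.1 (σ + x)⟫ * ⟪q, R.1 (σ - x)⟫ + ⟪q, R.1 (σ + x)⟫ * ⟪p, R.1 (σ - x)⟫) := by
    intro R
    rw [hg, hg, coe_orthAct, coe_orthAct, map_add, map_sub]
    simp only [inner_add_right, inner_sub_right]
    ring
  rcases (one_sub_sdot_sq_nonneg x σ).eq_or_lt with h0 | hpos
  · rw [← ht] at h0
    have hzero : ∀ R : OrthGroup d, g (orthAct R σ) - g (orthAct R x) = 0 := by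
      intro R
      rw [hpol]
      rcases sq_eq_one_iff.1 (show t ^ 2 = 1 by linarith) with h | h
      · rw [h, sub_eq_zero.2 (mul_one _).symm, sq_eq_zero_iff, norm_eq_zero] at hsub
        simp [hsub]
      · rw [h, show (2 : ℝ) + 2 * -1 = 0 by norm_num, sq_eq_zero_iff, norm_eq_zero] at hadd
        simp [hadd]
    simp [hzero, ← h0]
  · rw [← ht] at hpos
    have hn1 : ‖(σ : Euc d) + x‖ ≠ 0 := fun h => by rw [h] at hadd; nlinarith
    have hn2 : ‖(σ : Euc d) - x‖ ≠ 0 := fun h => by rw [h] at hsub; nlinarith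
    obtain ⟨u, hu⟩ := exists_eq_smul_coe (norm_ne_zero_iff.1 hn1)
    obtain ⟨v, hv⟩ := exists_eq_smul_coe (norm_ne_zero_iff.1 hn2)
    set n1 := ‖(σ : Euc d) + x‖
    set n2 := ‖(σ : Euc d) - x‖
    have huv : ⟪(u : Euc d), (v : Euc d)⟫ = 0 := by
      rw [hu, hv, inner_smul_left, inner_smul_right, ← mul_assoc] at hperp
      exact (mul_eq_zero.1 hperp).resolve_left (mul_ne_zero hn1 hn2)
    -- The free orthonormal pair is taken to be the directions of `σ + x` and `σ - x`. The
    -- derivative at `R u` along `R v` is the same bilinear form, so the integrands agree for every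
    -- `R`, with factor `n1² n2² / 4 = 1 - t²`.
    rw [lintegral_orth_pair_eq (fun x y => ENNReal.ofReal (⟪gradient (radialExt g) x, y⟫ ^ 2))
      (ha.trans (norm_eq_of_mem_sphere u).symm) (hb.trans (norm_eq_of_mem_sphere v).symm) hab huv,
      ← lintegral_const_mul' _ _ ENNReal.ofReal_ne_top]
    refine lintegral_congr fun R => ?_
    have hgrad : ⟪gradient (radialExt g) (R.1 u), R.1 v⟫ =
        ⟪p, R.1 u⟫ * ⟪q, R.1 v⟫ + ⟪q, R.1 u⟫ * ⟪p, R.1 v⟫ := by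
      rw [← hFd]
      exact inner_sphGrad_eq_fderiv hgs (hF.differentiable (by simp)) hg (orthAct R u)
        (by rw [coe_orthAct, inner_orth_apply, huv])
    rw [hpol, hgrad, ← ENNReal.ofReal_mul hpos.le, hu, hv]
    congr 1
    simp only [map_smul, inner_smul_right]
    have : (1 - t ^ 2) = (n1 ^ 2) * (n2 ^ 2) / 4 := by rw [hadd, hsub]; ring
    rw [this]
    ring

/-- At the point `p` the derivative in direction `q` is `1`, and the gradient is continuous. This
permits cancelling the gradient integral in the sharp case. -/
theorem lintegral_norm_sphGrad_inner_mul_inner_ne_zero {d : ℕ} {p q : Euc d} (hp : ‖p‖ = 1)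
    (hq : ‖q‖ = 1) (hpq : ⟪p, q⟫ = 0) {g : Sph d → ℝ}
    (hg : ∀ σ : Sph d, g σ = ⟪p, (σ : Euc d)⟫ * ⟪q, (σ : Euc d)⟫) :
    ∫⁻ x, ENNReal.ofReal (‖sphGrad g x‖ ^ 2) ∂(surf d) ≠ 0 := by
  have hF : ContDiff ℝ 1 fun x : Euc d => ⟪p, x⟫ * ⟪q, x⟫ :=
    (innerSL ℝ p).contDiff.mul (innerSL ℝ q).contDiff
  have hgs : SphContDiff 1 g := sphContDiff_of_contDiff (by exact_mod_cast hF) hg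
  have hc : Continuous fun x => ENNReal.ofReal (‖sphGrad g x‖ ^ 2) :=
    ENNReal.continuous_ofReal.comp (hgs.continuous_sphGrad.norm.pow 2)
  intro h
  have hz : (fun x => ENNReal.ofReal (‖sphGrad g x‖ ^ 2)) = fun _ => 0 :=
    (Continuous.ae_eq_iff_eq (surf d) hc continuous_const).1
      ((lintegral_eq_zero_iff hc.measurable).1 h)
  have h0 := congrFun hz ⟨p, by rw [mem_sphere_zero_iff_norm, hp]⟩
  rw [ENNReal.ofReal_eq_zero] at h0
  have h1 : sphGrad g ⟨p, by rw [mem_sphere_zero_iff_norm, hp]⟩ = 0 := by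
    have := pow_eq_zero_iff (two_ne_zero) |>.1 (le_antisymm h0 (sq_nonneg _))
    exact norm_eq_zero.1 this
  have h2 := inner_sphGrad_eq_fderiv hgs (hF.differentiable (by simp)) hg
    ⟨p, by rw [mem_sphere_zero_iff_norm, hp]⟩ (v := q) hpq
  have h : HasFDerivAt (fun x : Euc d => ⟪p, x⟫ * ⟪q, x⟫) _ p :=
    (innerSL ℝ p).hasFDerivAt.mul (innerSL ℝ q).hasFDerivAt
  rw [h1, inner_zero_left, h.fderiv] at h2
  simp [hp, hq, hpq] at h2

theorem lintegral_norm_sphGrad_sq_ne_top {d : ℕ} {g : Sph d → ℝ} (hg : SphContDiff 1 g) :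
    ∫⁻ x, ENNReal.ofReal (‖sphGrad g x‖ ^ 2) ∂(surf d) ≠ ⊤ := by
  have h : Continuous fun x => ‖sphGrad g x‖ ^ 2 := hg.continuous_sphGrad.norm.pow 2
  exact h.integrable_surf.lintegral_lt_top.ne

/-! ### Zonal convolution and its gradient -/

/-- The convolution of `h` with the zonal polynomial `φ(⟪y, σ⟫)`, as a function on `ℝᵈ`. -/
noncomputable def zonalConv {d : ℕ} (φ : Polynomial ℝ) (h : Sph d → ℝ) (y : Euc d) : ℝ :=
  ∫ σ, φ.eval ⟪y, (σ : Euc d)⟫ * h σ ∂(surf d)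

theorem contDiff_eval (φ : Polynomial ℝ) {n : WithTop ℕ∞} : ContDiff ℝ n fun t => φ.eval t := by
  simp only [← Polynomial.coe_aeval_eq_eval]
  exact φ.contDiff_aeval n

theorem continuous_eval_inner {d : ℕ} (φ : Polynomial ℝ) (y : Euc d) :
    Continuous fun σ : Sph d => φ.eval ⟪y, (σ : Euc d)⟫ :=
  φ.continuous.comp (by fun_prop)

theorem exists_bound_eval_inner {d : ℕ} (φ : Polynomial ℝ) (y₀ : Euc d) :
    ∃ C, ∀ y ∈ Metric.ball y₀ 1, ∀ σ : Sph d, ‖φ.eval ⟪y, (σ : Euc d)⟫‖ ≤ C := by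
  obtain ⟨C, hC⟩ := (isCompact_Icc (a := -(‖y₀‖ + 1)) (b := ‖y₀‖ + 1)).exists_bound_of_continuousOn
    φ.continuous.continuousOn
  refine ⟨C, fun y hy σ => hC _ (abs_le.1 ?_)⟩
  refine (abs_real_inner_le_norm _ _).trans ?_
  rw [norm_eq_of_mem_sphere, mul_one]
  have : ‖y‖ ≤ ‖y₀‖ + ‖y - y₀‖ := norm_le_norm_add_norm_sub' _ _ |>.trans (by rw [])
  rw [mem_ball_iff_norm] at hy
  linarith

theorem Continuous.mul_integrable_surf {d : ℕ} {f h : Sph d → ℝ} (hf : Continuous f)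
    (hh : Integrable h (surf d)) : Integrable (fun σ => f σ * h σ) (surf d) := by
  obtain ⟨C, hC⟩ := isCompact_univ.exists_bound_of_continuousOn hf.continuousOn
  exact hh.bdd_mul hf.aestronglyMeasurable (Eventually.of_forall fun x => hC x (mem_univ x))

/-- The derivative of the polynomial kernel is bounded uniformly in `σ` for `y` in a ball, so mere
integrability of `h` allows differentiation under the integral. -/
theorem hasFDerivAt_zonalConv {d : ℕ} (φ : Polynomial ℝ) {h : Sph d → ℝ}
    (hh : Integrable h (surf d)) (y : Euc d) :
    HasFDerivAt (zonalConv φ h)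
      (∫ σ : Sph d, (φ.derivative.eval ⟪y, (σ : Euc d)⟫ * h σ) • innerSL ℝ (σ : Euc d) ∂(surf d))
      y := by
  obtain ⟨C, hC⟩ := exists_bound_eval_inner (d := d) φ.derivative y
  refine hasFDerivAt_integral_of_dominated_of_fderiv_le (bound := fun σ => C * ‖h σ‖)
    (F' := fun y (σ : Sph d) => (φ.derivative.eval ⟪y, (σ : Euc d)⟫ * h σ) • innerSL ℝ (σ : Euc d))
    (Metric.ball_mem_nhds y one_pos)
    (Eventually.of_forall fun y => ?_) ?_ ?_ (Eventually.of_forall fun σ y hy => ?_)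
    (hh.norm.const_mul C) (Eventually.of_forall fun σ y _ => ?_)
  · exact ((continuous_eval_inner φ y).mul_integrable_surf hh).aestronglyMeasurable
  · exact (continuous_eval_inner φ y).mul_integrable_surf hh
  · exact ((continuous_eval_inner _ y).mul_integrable_surf hh).aestronglyMeasurable.smul
      ((innerSL ℝ).continuous.comp continuous_subtype_val).aestronglyMeasurable
  · rw [norm_smul, norm_mul, innerSL_apply_norm, norm_eq_of_mem_sphere, mul_one]
    exact mul_le_mul_of_nonneg_right (hC y hy σ) (norm_nonneg _)
  · have h1 : HasFDerivAt (fun y : Euc d => ⟪y, (σ : Euc d)⟫) (innerSL ℝ (σ : Euc d)) y := by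
      have : (fun y : Euc d => ⟪y, (σ : Euc d)⟫) = innerSL ℝ (σ : Euc d) :=
        funext fun y => real_inner_comm _ _
      rw [this]
      exact (innerSL ℝ (σ : Euc d)).hasFDerivAt
    have h2 := ((φ.hasDerivAt ⟪y, (σ : Euc d)⟫).comp_hasFDerivAt y h1).mul_const (h σ)
    refine h2.congr_fderiv ?_
    rw [smul_smul, mul_comm]

theorem fderiv_zonalConv_apply {d : ℕ} (φ : Polynomial ℝ) {h : Sph d → ℝ}
    (hh : Integrable h (surf d)) (y v : Euc d) :
    fderiv ℝ (zonalConv φ h) y v =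
      ∫ σ : Sph d, φ.derivative.eval ⟪y, (σ : Euc d)⟫ * h σ * ⟪(σ : Euc d), v⟫ ∂(surf d) := by
  rw [(hasFDerivAt_zonalConv φ hh y).fderiv, ContinuousLinearMap.integral_apply]
  · rfl
  · have hi := (continuous_eval_inner φ.derivative y).mul_integrable_surf hh
    refine hi.norm.mono' (hi.aestronglyMeasurable.smul
      ((innerSL ℝ).continuous.comp continuous_subtype_val).aestronglyMeasurable)
      (Eventually.of_forall fun σ => ?_)
    rw [norm_smul, innerSL_apply_norm, norm_eq_of_mem_sphere, mul_one]

theorem contDiff_zonalConv {d : ℕ} (φ : Polynomial ℝ) {h : Sph d → ℝ}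
    (hh : Integrable h (surf d)) : ContDiff ℝ 1 (zonalConv φ h) := by
  rw [contDiff_one_iff_fderiv]
  refine ⟨fun y => (hasFDerivAt_zonalConv φ hh y).differentiableAt, ?_⟩
  rw [funext fun y => (hasFDerivAt_zonalConv φ hh y).fderiv]
  refine continuous_iff_continuousAt.2 fun y => ?_
  obtain ⟨C, hC⟩ := exists_bound_eval_inner (d := d) φ.derivative y
  refine continuousAt_of_dominated (bound := fun σ => C * ‖h σ‖) (Eventually.of_forall fun y => ?_)
    ?_ (hh.norm.const_mul C) (Eventually.of_forall fun σ => ?_)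
  · exact ((continuous_eval_inner _ y).mul_integrable_surf hh).aestronglyMeasurable.smul
      ((innerSL ℝ).continuous.comp continuous_subtype_val).aestronglyMeasurable
  · filter_upwards [Metric.ball_mem_nhds y one_pos] with z hz
    refine Eventually.of_forall fun σ => ?_
    rw [norm_smul, norm_mul, innerSL_apply_norm, norm_eq_of_mem_sphere, mul_one]
    exact mul_le_mul_of_nonneg_right (hC z hz σ) (norm_nonneg _)
  · refine Continuous.continuousAt ?_
    exact ((φ.derivative.continuous.comp (by fun_prop)).mul continuous_const).smul continuous_const

theorem orthAct_neg_one {d : ℕ} (σ : Sph d) : orthAct (-1) σ = -σ := Subtype.ext rfl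

/-- Substituting `-σ` for `σ` turns evenness almost everywhere into evenness everywhere, as the `C¹`
inequality demands. -/
theorem zonalConv_neg {d : ℕ} (φ : Polynomial ℝ) {h : Sph d → ℝ}
    (hh : Integrable h (surf d)) (heven : ∀ᵐ σ ∂(surf d), h (-σ) = h σ) (y : Euc d) :
    zonalConv φ h (-y) = zonalConv φ h y := by
  rw [zonalConv, ← integral_orthAct (-1)
    ((continuous_eval_inner φ (-y)).mul_integrable_surf hh).aestronglyMeasurable]
  refine integral_congr_ae ?_
  filter_upwards [heven] with σ hσ
  rw [orthAct_neg_one, hσ, show ((-σ : Sph d) : Euc d) = -(σ : Euc d) from rfl, inner_neg_neg]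

theorem lintegral_lintegral_zonal {d : ℕ} {φ : Polynomial ℝ}
    (h0 : ∀ t ∈ Icc (-1 : ℝ) 1, 0 ≤ φ.eval t)
    (h1 : ∀ x : Sph d, ∫ σ, φ.eval (sdot x σ) ∂(surf d) = 1)
    {H : Sph d → ℝ≥0∞} (hH : AEMeasurable H (surf d)) :
    ∫⁻ x, ∫⁻ σ, ENNReal.ofReal (φ.eval (sdot x σ)) * H σ ∂(surf d) ∂(surf d) =
      ∫⁻ σ, H σ ∂(surf d) := by
  have hφ : Continuous fun p : Sph d × Sph d => ENNReal.ofReal (φ.eval (sdot p.1 p.2)) :=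
    ENNReal.continuous_ofReal.comp (φ.continuous.comp continuous_sdot)
  have hm : AEMeasurable (fun p : Sph d × Sph d => ENNReal.ofReal (φ.eval (sdot p.1 p.2)) * H p.2)
      ((surf d).prod (surf d)) := hφ.measurable.aemeasurable.mul hH.comp_snd
  have hone : ∀ σ : Sph d, ∫⁻ x, ENNReal.ofReal (φ.eval (sdot x σ)) ∂(surf d) = 1 := by
    intro σ
    have hc : ∀ x, sdot x σ = sdot σ x := fun x => real_inner_comm _ _
    simp only [hc]
    rw [← ofReal_integral_eq_lintegral_ofReal, h1, ENNReal.ofReal_one]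
    · exact (continuous_eval_inner φ (σ : Euc d)).integrable_surf
    · exact Eventually.of_forall fun x => h0 _ (sdot_mem_Icc _ _)
  rw [lintegral_lintegral_swap hm]
  refine lintegral_congr fun σ => ?_
  have hφσ : Continuous fun x : Sph d => ENNReal.ofReal (φ.eval (sdot x σ)) :=
    hφ.comp (Continuous.prodMk_left σ)
  rw [lintegral_mul_const _ hφσ.measurable, hone, one_mul]

/-- As `x` and `v` are orthogonal, the left side squared is `|v|²` times the squared length of the
projection of `y` to their span: Bessel's inequality. -/
theorem norm_rotGen_apply_le {d : ℕ} {x v y : Euc d} (hx : ‖x‖ = 1) (hy : ‖y‖ = 1)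
    (hxv : ⟪x, v⟫ = 0) : ‖rotGen x v y‖ ≤ ‖v‖ := by
  refine le_of_sq_le_sq ?_ (norm_nonneg _)
  have hvx : ⟪v, x⟫ = 0 := by rw [real_inner_comm, hxv]
  have hyx : ⟪y, x⟫ = ⟪x, y⟫ := real_inner_comm _ _
  have hyv : ⟪y, v⟫ = ⟪v, y⟫ := real_inner_comm _ _
  have h1 : ‖rotGen x v y‖ ^ 2 = ⟪x, y⟫ ^ 2 * ‖v‖ ^ 2 + ⟪v, y⟫ ^ 2 := by
    rw [rotGen_apply, norm_sub_sq_real, norm_smul, norm_smul, inner_smul_left, inner_smul_right,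
      hvx, hx, mul_pow, mul_pow]
    simp
  rw [h1]
  -- This vector is `|v|²` times the part of `y` orthogonal to `x` and `v`; the scaling avoids
  -- dividing by `|v|`.
  have h2 : 0 ≤ ‖(‖v‖ ^ 2) • y - (‖v‖ ^ 2 * ⟪x, y⟫) • x - ⟪v, y⟫ • v‖ ^ 2 := sq_nonneg _
  have h3 : ‖(‖v‖ ^ 2) • y - (‖v‖ ^ 2 * ⟪x, y⟫) • x - ⟪v, y⟫ • v‖ ^ 2 =
      ‖v‖ ^ 2 * (‖v‖ ^ 2 - ⟪x, y⟫ ^ 2 * ‖v‖ ^ 2 - ⟪v, y⟫ ^ 2) := by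
    rw [← real_inner_self_eq_norm_sq]
    simp only [inner_sub_left, inner_sub_right, inner_smul_left, inner_smul_right,
      real_inner_self_eq_norm_sq, hx, hy, hxv, hvx, hyx, hyv, conj_trivial]
    ring
  rcases eq_or_ne v 0 with rfl | hv
  · simp
  · have hv' : 0 < ‖v‖ ^ 2 := by positivity
    rw [h3] at h2
    have := nonneg_of_mul_nonneg_right h2 hv'
    linarith

/-- Convolution with a zonal probability density does not increase the norm of the gradient. -/
theorem norm_sphGrad_zonalConv_sq_le {d : ℕ} {φ : Polynomial ℝ}
    (h0 : ∀ t ∈ Icc (-1 : ℝ) 1, 0 ≤ φ.eval t)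
    (h1 : ∀ x : Sph d, ∫ σ, φ.eval (sdot x σ) ∂(surf d) = 1)
    {g : Sph d → ℝ} {G : Sph d → Euc d} (hg : HasWeakGrad g G) (x : Sph d) :
    ‖sphGrad (fun σ : Sph d => zonalConv φ g σ) x‖ ^ 2 ≤
      ∫ σ, φ.eval (sdot x σ) * ‖G σ‖ ^ 2 ∂(surf d) := by
  have hgi : Integrable g (surf d) := hg.memLp.integrable one_le_two
  have hGi : Integrable G (surf d) := hg.memLp_grad.integrable one_le_two
  have hG2 : Integrable (fun σ => ‖G σ‖ ^ 2) (surf d) := hg.memLp_grad.integrable_norm_pow two_ne_zero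
  have hF := contDiff_zonalConv φ hgi
  have hgs : SphContDiff 1 (fun σ : Sph d => zonalConv φ g σ) :=
    sphContDiff_of_contDiff (by exact_mod_cast hF) fun σ => rfl
  have hx := norm_eq_of_mem_sphere x
  have hφx : Continuous fun σ : Sph d => φ.eval (sdot x σ) := continuous_eval_inner φ (x : Euc d)
  set v := sphGrad (fun σ : Sph d => zonalConv φ g σ) x with hv
  have hxv : ⟪(x : Euc d), v⟫ = 0 := by
    rw [real_inner_comm]; exact hgs.inner_gradient_self (coe_sph_ne_zero x)
  have hψ : ContDiff ℝ ∞ fun y : Euc d => φ.eval ⟪(x : Euc d), y⟫ :=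
    (contDiff_eval φ).comp (innerSL ℝ (x : Euc d)).contDiff
  -- The test field is the kernel times the infinitesimal rotation taking the value `v` at `x`. The
  -- rotation is divergence-free, so the divergence is minus the derivative of the kernel in `x`
  -- along `v`: the derivative passes from the kernel to `g`.
  have hweak := hg.integral_eq (fun y => φ.eval ⟪(x : Euc d), y⟫ • rotGen (x : Euc d) v y)
    (hψ.smul (rotGen (x : Euc d) v).contDiff) fun σ => by
      rw [inner_smul_left, inner_rotGen_self, mul_zero]
  have hdiv : ∀ σ : Sph d, sphDiv (fun y => φ.eval ⟪(x : Euc d), y⟫ • rotGen (x : Euc d) v y) σ =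
      -(φ.derivative.eval ⟪(x : Euc d), (σ : Euc d)⟫ * ⟪(σ : Euc d), v⟫) := by
    intro σ
    rw [sphDiv_smul σ (hψ.differentiable (by simp) _) (rotGen (x : Euc d) v).differentiableAt
      (inner_rotGen_self _ _ _), sphDiv_skew (inner_rotGen_self _ _)]
    have h : HasFDerivAt (fun y : Euc d => φ.eval ⟪(x : Euc d), y⟫) _ (σ : Euc d) :=
      (φ.hasDerivAt ⟪(x : Euc d), (σ : Euc d)⟫).comp_hasFDerivAt (σ : Euc d)
        (innerSL ℝ (x : Euc d)).hasFDerivAt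
    rw [h.fderiv]
    simp [rotGen_apply, inner_sub_right, inner_smul_right, hxv, hx, real_inner_comm]
  have hvv : ‖v‖ ^ 2 = ∫ σ, φ.eval (sdot x σ) * ⟪G σ, rotGen (x : Euc d) v σ⟫ ∂(surf d) := by
    rw [← real_inner_self_eq_norm_sq, hv, inner_sphGrad_eq_fderiv hgs
      (hF.differentiable (by simp)) (fun σ => rfl) x hxv, fderiv_zonalConv_apply φ hgi]
    simp only [inner_smul_right, hdiv] at hweak
    refine Eq.trans ?_ hweak.symm
    rw [← integral_neg]
    exact integral_congr_ae (Eventually.of_forall fun σ => by simp only; ring)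
  have hint1 : Integrable (fun σ => φ.eval (sdot x σ) * ‖G σ‖) (surf d) :=
    hφx.mul_integrable_surf hGi.norm
  have hint2 : Integrable (fun σ => φ.eval (sdot x σ) * ‖G σ‖ ^ 2) (surf d) :=
    hφx.mul_integrable_surf hG2
  set m := ∫ σ, φ.eval (sdot x σ) * ‖G σ‖ ∂(surf d) with hm
  have hvm : ‖v‖ ^ 2 ≤ m * ‖v‖ := by
    rw [hvv, hm, ← integral_mul_const]
    have hb : ∀ σ, ‖φ.eval (sdot x σ) * ⟪G σ, rotGen (x : Euc d) v σ⟫‖ ≤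
        φ.eval (sdot x σ) * ‖G σ‖ * ‖v‖ := fun σ => by
      have hp := h0 _ (sdot_mem_Icc x σ)
      rw [norm_mul, Real.norm_of_nonneg hp, mul_assoc]
      exact mul_le_mul_of_nonneg_left ((norm_inner_le_norm _ _).trans (mul_le_mul_of_nonneg_left
        (norm_rotGen_apply_le hx (norm_eq_of_mem_sphere σ) hxv) (norm_nonneg _))) hp
    refine integral_mono ((hint1.mul_const ‖v‖).mono' ?_ (Eventually.of_forall hb))
      (hint1.mul_const _) fun σ => (le_abs_self _).trans (hb σ)
    exact hφx.aestronglyMeasurable.mul (hGi.aestronglyMeasurable.inner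
      ((rotGen (x : Euc d) v).continuous.comp continuous_subtype_val).aestronglyMeasurable)
  have hm0 : 0 ≤ m := integral_nonneg fun σ =>
    mul_nonneg (h0 _ (sdot_mem_Icc x σ)) (norm_nonneg _)
  have hvm' : ‖v‖ ≤ m := by
    by_contra! hlt
    nlinarith [norm_nonneg v]
  -- Jensen's inequality `m² ≤ ∫ φ |G|²`, obtained from nonnegativity of the variance.
  have hvar : 0 ≤ ∫ σ, φ.eval (sdot x σ) * (‖G σ‖ - m) ^ 2 ∂(surf d) := integral_nonneg fun σ =>
    mul_nonneg (h0 _ (sdot_mem_Icc x σ)) (sq_nonneg _)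
  have hexp : ∀ σ, φ.eval (sdot x σ) * (‖G σ‖ - m) ^ 2 =
      φ.eval (sdot x σ) * ‖G σ‖ ^ 2 - (2 * m) * (φ.eval (sdot x σ) * ‖G σ‖) +
        m ^ 2 * φ.eval (sdot x σ) := fun σ => by ring
  have hint3 : Integrable (fun σ => φ.eval (sdot x σ) * ‖G σ‖ ^ 2 -
      (2 * m) * (φ.eval (sdot x σ) * ‖G σ‖)) (surf d) := hint2.sub (hint1.const_mul _)
  simp only [hexp] at hvar
  rw [integral_add hint3 (hφx.integrable_surf.const_mul _),
    integral_sub hint2 (hint1.const_mul _), integral_const_mul, integral_const_mul, h1, ← hm] at hvar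
  nlinarith [norm_nonneg v]

theorem lintegral_norm_sphGrad_zonalConv_sq_le {d : ℕ} {φ : Polynomial ℝ}
    (h0 : ∀ t ∈ Icc (-1 : ℝ) 1, 0 ≤ φ.eval t)
    (h1 : ∀ x : Sph d, ∫ σ, φ.eval (sdot x σ) ∂(surf d) = 1)
    {g : Sph d → ℝ} {G : Sph d → Euc d} (hg : HasWeakGrad g G) :
    ∫⁻ x, ENNReal.ofReal (‖sphGrad (fun σ : Sph d => zonalConv φ g σ) x‖ ^ 2) ∂(surf d) ≤
      ∫⁻ x, ENNReal.ofReal (‖G x‖ ^ 2) ∂(surf d) := by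
  have hG2 : Integrable (fun σ => ‖G σ‖ ^ 2) (surf d) := hg.memLp_grad.integrable_norm_pow two_ne_zero
  rw [← lintegral_lintegral_zonal h0 h1 hG2.aestronglyMeasurable.aemeasurable.ennreal_ofReal]
  refine lintegral_mono fun x => ?_
  have hφx : Continuous fun σ : Sph d => φ.eval (sdot x σ) := continuous_eval_inner φ (x : Euc d)
  have hpos := fun σ => h0 _ (sdot_mem_Icc x σ)
  refine (ENNReal.ofReal_le_ofReal (norm_sphGrad_zonalConv_sq_le h0 h1 hg x)).trans_eq ?_
  rw [ofReal_integral_eq_lintegral_ofReal (hφx.mul_integrable_surf hG2)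
    (Eventually.of_forall fun σ => mul_nonneg (hpos σ) (sq_nonneg _))]
  exact lintegral_congr fun σ => ENNReal.ofReal_mul (hpos σ)

theorem lintegral_enorm_zonalConv_le {d : ℕ} {φ : Polynomial ℝ}
    (h0 : ∀ t ∈ Icc (-1 : ℝ) 1, 0 ≤ φ.eval t)
    (h1 : ∀ x : Sph d, ∫ σ, φ.eval (sdot x σ) ∂(surf d) = 1)
    {h : Sph d → ℝ} (hh : Integrable h (surf d)) :
    ∫⁻ x : Sph d, ‖zonalConv φ h x‖ₑ ∂(surf d) ≤ ∫⁻ x, ‖h x‖ₑ ∂(surf d) := by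
  rw [← lintegral_lintegral_zonal h0 h1 hh.aestronglyMeasurable.enorm]
  refine lintegral_mono fun x => (enorm_integral_le_lintegral_enorm _).trans_eq ?_
  refine lintegral_congr fun σ => ?_
  rw [enorm_mul, ← Real.enorm_of_nonneg (h0 _ (sdot_mem_Icc x σ))]
  rfl

theorem integral_comp_sdot {d : ℕ} {f : ℝ → ℝ} (hf : Continuous f) (x k : Sph d) :
    ∫ σ, f (sdot x σ) ∂(surf d) = ∫ σ, f (sdot k σ) ∂(surf d) := by
  obtain ⟨Q, hQ, -⟩ := exists_orth_apply_eq (a := (x : Euc d)) (a' := (k : Euc d))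
    (by rw [norm_eq_of_mem_sphere, norm_eq_of_mem_sphere])
  have hk : k = orthAct Q x := Subtype.ext hQ.symm
  have hc : Continuous fun σ => f (sdot k σ) :=
    hf.comp (continuous_sdot.comp (Continuous.prodMk_right k))
  rw [← integral_orthAct Q hc.aestronglyMeasurable, hk]
  simp only [sdot_orthAct]

/-! ### Approximation by zonal peaks and passage to `H¹` -/

/-- The polynomials `((1 + t) / 2) ^ n`, normalised so as to define zonal probability densities
which concentrate at `t = 1` as `n` tends to infinity. -/
noncomputable def zonalPeak {d : ℕ} (k : Sph d) (n : ℕ) : Polynomial ℝ :=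
  Polynomial.C (∫ σ, ((1 + sdot k σ) / 2) ^ n ∂(surf d))⁻¹ *
    (Polynomial.C (1 / 2) * (1 + Polynomial.X)) ^ n

theorem eval_zonalPeak {d : ℕ} (k : Sph d) (n : ℕ) (t : ℝ) : (zonalPeak k n).eval t =
    (∫ σ, ((1 + sdot k σ) / 2) ^ n ∂(surf d))⁻¹ * ((1 + t) / 2) ^ n := by
  simp only [zonalPeak, Polynomial.eval_mul, Polynomial.eval_C, Polynomial.eval_pow,
    Polynomial.eval_add, Polynomial.eval_one, Polynomial.eval_X]
  ring_nf

theorem zonalPeak_nonneg {d : ℕ} (k : Sph d) (n : ℕ) :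
    ∀ t ∈ Icc (-1 : ℝ) 1, 0 ≤ (zonalPeak k n).eval t := by
  intro t ht
  rw [eval_zonalPeak]
  refine mul_nonneg (inv_nonneg.2 (integral_nonneg fun σ => pow_nonneg ?_ n)) (pow_nonneg ?_ n)
  · have := (sdot_mem_Icc k σ).1; linarith
  · have := ht.1; linarith

theorem sdot_self {d : ℕ} (x : Sph d) : sdot x x = 1 := by
  rw [sdot, real_inner_self_eq_norm_sq, norm_eq_of_mem_sphere, one_pow]

theorem integral_zonalPeak {d : ℕ} (k : Sph d) (n : ℕ) (x : Sph d) :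
    ∫ σ, (zonalPeak k n).eval (sdot x σ) ∂(surf d) = 1 := by
  simp only [eval_zonalPeak]
  rw [integral_const_mul, integral_comp_sdot (f := fun t => ((1 + t) / 2) ^ n) (by fun_prop) x k]
  refine inv_mul_cancel₀ (ne_of_gt ?_)
  have hc : Continuous fun σ : Sph d => ((1 + sdot k σ) / 2) ^ n :=
    (((continuous_sdot.comp (Continuous.prodMk_right k)).const_add 1).div_const 2).pow n
  refine hc.integral_pos_of_hasCompactSupport_nonneg_nonzero (x := k)
    (HasCompactSupport.of_compactSpace _) (fun σ => pow_nonneg ?_ n) ?_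
  · have := (sdot_mem_Icc k σ).1; linarith
  · rw [sdot_self]; norm_num

theorem sdot_lt_one {d : ℕ} {x σ : Sph d} (h : σ ≠ x) : sdot x σ < 1 :=
  (inner_lt_one_iff_real_of_norm_eq_one (norm_eq_of_mem_sphere x) (norm_eq_of_mem_sphere σ)).2
    fun h' => h (Subtype.ext h'.symm)

/-- On the sphere `(1 + x·σ)/2` has its unique maximum at `σ = x`, so its normalised powers form an
approximate identity. -/
theorem tendsto_zonalConv_zonalPeak {d : ℕ} (k x : Sph d) {f : Sph d → ℝ} (hf : Continuous f) :
    Tendsto (fun n => zonalConv (zonalPeak k n) f x) atTop (𝓝 (f x)) := by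
  have hc : Continuous fun σ : Sph d => (1 + sdot x σ) / 2 :=
    ((continuous_sdot.comp (Continuous.prodMk_right x)).const_add 1).div_const 2
  have h := tendsto_setIntegral_pow_smul_of_unique_maximum_of_isCompact_of_continuousOn
    (μ := surf d) (s := univ) (x₀ := x) (c := fun σ => (1 + sdot x σ) / 2) (g := f)
    isCompact_univ hc.continuousOn
    (fun σ _ hσ => by simp only [sdot_self]; have := sdot_lt_one hσ; linarith)
    (fun σ _ => by have := (sdot_mem_Icc x σ).1; linarith)
    (by rw [sdot_self]; norm_num) (by simp) hf.continuousOn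
  simp only [Measure.restrict_univ, smul_eq_mul] at h
  refine h.congr fun n => ?_
  rw [zonalConv, integral_comp_sdot (f := fun t => ((1 + t) / 2) ^ n) (by fun_prop) x k,
    ← integral_const_mul]
  refine integral_congr_ae (Eventually.of_forall fun σ => ?_)
  simp only
  rw [show ⟪(x : Euc d), (σ : Euc d)⟫ = sdot x σ from rfl, eval_zonalPeak, mul_assoc]

theorem zonalConv_sub {d : ℕ} (φ : Polynomial ℝ) {h f : Sph d → ℝ} (hh : Integrable h (surf d))
    (hf : Integrable f (surf d)) (y : Euc d) :
    zonalConv φ (fun σ => h σ - f σ) y = zonalConv φ h y - zonalConv φ f y := by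
  simp only [zonalConv, mul_sub]
  exact integral_sub ((continuous_eval_inner φ y).mul_integrable_surf hh)
    ((continuous_eval_inner φ y).mul_integrable_surf hf)

/-- Density of continuous functions and contractivity of the convolution in `L¹` reduce this to the
continuous case. `L¹` suffices, as only convergence almost everywhere of a subsequence is used
later. -/
theorem tendsto_lintegral_enorm_zonalConv_sub {d : ℕ} (k : Sph d) {h : Sph d → ℝ}
    (hh : Integrable h (surf d)) :
    Tendsto (fun n => ∫⁻ x : Sph d, ‖zonalConv (zonalPeak k n) h x - h x‖ₑ ∂(surf d)) atTop
      (𝓝 0) := by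
  rw [ENNReal.tendsto_nhds_zero]
  intro ε hε
  have hε3 : ε / 3 ≠ 0 := (ENNReal.div_pos hε.ne' (by simp)).ne'
  obtain ⟨f, hfε, hfi⟩ := hh.exists_boundedContinuous_lintegral_sub_le hε3
  have hcont : ∀ n (u : Sph d → ℝ), Integrable u (surf d) →
      Continuous fun x : Sph d => zonalConv (zonalPeak k n) u x := fun n u hu =>
    (contDiff_zonalConv _ hu).continuous.comp continuous_subtype_val
  have hbound : ∀ n (x : Sph d), |zonalConv (zonalPeak k n) f x| ≤ ‖f‖ := by
    intro n x
    have hpos := fun σ => zonalPeak_nonneg k n _ (sdot_mem_Icc x σ)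
    have hc : Continuous fun σ : Sph d => (zonalPeak k n).eval (sdot x σ) :=
      continuous_eval_inner _ (x : Euc d)
    calc |zonalConv (zonalPeak k n) f x|
        ≤ ∫ σ, (zonalPeak k n).eval (sdot x σ) * ‖f‖ ∂(surf d) := by
          rw [← Real.norm_eq_abs, zonalConv]
          refine norm_integral_le_of_norm_le (hc.integrable_surf.mul_const ‖f‖)
            (Eventually.of_forall fun σ => ?_)
          change ‖(zonalPeak k n).eval (sdot x σ) * f σ‖ ≤ _
          rw [norm_mul, Real.norm_of_nonneg (hpos σ)]
          exact mul_le_mul_of_nonneg_left (f.norm_coe_le_norm σ) (hpos σ)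
      _ = ‖f‖ := by rw [integral_mul_const, integral_zonalPeak, one_mul]
  have hmid : Tendsto (fun n => ∫⁻ x : Sph d, ‖zonalConv (zonalPeak k n) f x - f x‖ₑ ∂(surf d))
      atTop (𝓝 0) := by
    have := tendsto_lintegral_of_dominated_convergence (μ := surf d)
      (F := fun n (x : Sph d) => ‖zonalConv (zonalPeak k n) f x - f x‖ₑ) (f := fun _ => 0)
      (fun _ => ENNReal.ofReal (2 * ‖f‖))
      (fun n => ((hcont n f hfi).sub f.continuous).enorm.measurable)
      (fun n => Eventually.of_forall fun x => ?_) ?_ (Eventually.of_forall fun x => ?_)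
    · simpa using this
    · change ‖zonalConv (zonalPeak k n) f x - f x‖ₑ ≤ ENNReal.ofReal (2 * ‖f‖)
      rw [Real.enorm_eq_ofReal_abs]
      refine ENNReal.ofReal_le_ofReal ((abs_sub _ _).trans ?_)
      have := hbound n x
      have := f.norm_coe_le_norm x
      rw [Real.norm_eq_abs] at this
      linarith
    · rw [lintegral_const]
      exact ENNReal.mul_ne_top ENNReal.ofReal_ne_top (measure_ne_top _ _)
    · have h1 := ((tendsto_zonalConv_zonalPeak k x f.continuous).sub_const (f x)).enorm
      simpa using h1
  filter_upwards [ENNReal.tendsto_nhds_zero.1 hmid _ (pos_iff_ne_zero.2 hε3)] with n hn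
  have hcontr := lintegral_enorm_zonalConv_le (zonalPeak_nonneg k n) (integral_zonalPeak k n)
    (hh.sub hfi)
  have hsplit : ∀ x : Sph d, ‖zonalConv (zonalPeak k n) h x - h x‖ₑ ≤
      ‖zonalConv (zonalPeak k n) (fun σ => h σ - f σ) x‖ₑ +
        (‖zonalConv (zonalPeak k n) f x - f x‖ₑ + ‖h x - f x‖ₑ) := by
    intro x
    rw [zonalConv_sub _ hh hfi, ← enorm_neg (h x - f x)]
    refine le_trans (le_of_eq ?_) ((enorm_add_le _ _).trans (add_le_add_right (enorm_add_le _ _) _))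
    congr 1
    ring
  calc ∫⁻ x : Sph d, ‖zonalConv (zonalPeak k n) h x - h x‖ₑ ∂(surf d)
      ≤ ∫⁻ x : Sph d, (‖zonalConv (zonalPeak k n) (fun σ => h σ - f σ) x‖ₑ +
        (‖zonalConv (zonalPeak k n) f x - f x‖ₑ + ‖h x - f x‖ₑ)) ∂(surf d) :=
        lintegral_mono hsplit
    _ = ∫⁻ x : Sph d, ‖zonalConv (zonalPeak k n) (fun σ => h σ - f σ) x‖ₑ ∂(surf d) +
        (∫⁻ x : Sph d, ‖zonalConv (zonalPeak k n) f x - f x‖ₑ ∂(surf d) +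
          ∫⁻ x, ‖h x - f x‖ₑ ∂(surf d)) := by
        have hm1 : Measurable fun x : Sph d =>
            ‖zonalConv (zonalPeak k n) (fun σ => h σ - f σ) x‖ₑ :=
          (hcont n _ (hh.sub hfi)).enorm.measurable
        have hm2 : Measurable fun x : Sph d => ‖zonalConv (zonalPeak k n) f x - f x‖ₑ :=
          ((hcont n f hfi).sub f.continuous).enorm.measurable
        rw [lintegral_add_left hm1, lintegral_add_left hm2]
    _ ≤ ε / 3 + (ε / 3 + ε / 3) := by
        gcongr
        exact hcontr.trans hfε
    _ = ε := by rw [← add_assoc, ENNReal.add_thirds]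

theorem lintegral_lintegral_liminf_le {α : Type*} [MeasurableSpace α] {μ : Measure α} [SFinite μ]
    {F : ℕ → α → α → ℝ≥0∞} (hF : ∀ n, Measurable fun p : α × α => F n p.1 p.2) :
    ∫⁻ x, ∫⁻ y, liminf (fun n => F n x y) atTop ∂μ ∂μ ≤
      liminf (fun n => ∫⁻ x, ∫⁻ y, F n x y ∂μ ∂μ) atTop :=
  (lintegral_mono fun _ => lintegral_liminf_le fun n => (hF n).comp measurable_prodMk_left).trans
    (lintegral_liminf_le fun n => (hF n).lintegral_prod_right')

/-- Lower semicontinuity of the energy with respect to convergence almost everywhere. -/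
theorem lintegral_gammaBeta_le_of_tendsto {d : ℕ} {β : ℝ → ℝ} (hβ : Measurable β)
    {g : Sph d → ℝ} {u : ℕ → Sph d → ℝ} (hu : ∀ n, Continuous (u n))
    (hlim : ∀ᵐ x ∂(surf d), Tendsto (fun n => u n x) atTop (𝓝 (g x))) {C : ℝ≥0∞}
    (hC : ∀ n, ∫⁻ x, gammaBeta β (u n) x ∂(surf d) ≤ C) :
    ∫⁻ x, gammaBeta β g x ∂(surf d) ≤ C := by
  have h2 : (2⁻¹ : ℝ≥0∞) ≠ ⊤ := ENNReal.inv_ne_top.2 two_ne_zero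
  have heq : ∀ v : Sph d → ℝ, ∫⁻ x, gammaBeta β v x ∂(surf d) = ∫⁻ x, ∫⁻ σ,
      2⁻¹ * ENNReal.ofReal ((v σ - v x) ^ 2 * β (sdot x σ)) ∂(surf d) ∂(surf d) := fun v =>
    lintegral_congr fun x => (lintegral_const_mul' _ _ h2).symm
  have hmeas : ∀ n, Measurable fun p : Sph d × Sph d =>
      2⁻¹ * ENNReal.ofReal ((u n p.2 - u n p.1) ^ 2 * β (sdot p.1 p.2)) := fun n =>
    (measurable_energy_integrand hβ (hu n)).const_mul _
  have hfatou := lintegral_lintegral_liminf_le (μ := surf d)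
    (F := fun n x σ => 2⁻¹ * ENNReal.ofReal ((u n σ - u n x) ^ 2 * β (sdot x σ))) hmeas
  simp only [← heq] at hfatou
  calc ∫⁻ x, gammaBeta β g x ∂(surf d)
      ≤ ∫⁻ x, ∫⁻ σ, liminf (fun n =>
          2⁻¹ * ENNReal.ofReal ((u n σ - u n x) ^ 2 * β (sdot x σ))) atTop ∂(surf d) ∂(surf d) := by
        rw [heq]
        refine lintegral_mono_ae ?_
        filter_upwards [hlim] with x hx
        refine lintegral_mono_ae ?_
        filter_upwards [hlim] with σ hσ
        have ht := (ENNReal.continuous_ofReal.tendsto _).comp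
          (((hσ.sub hx).pow 2).mul_const (β (sdot x σ)))
        exact (ENNReal.Tendsto.const_mul ht (Or.inr h2)).liminf_eq.ge
    _ ≤ liminf (fun n => ∫⁻ x, gammaBeta β (u n) x ∂(surf d)) atTop := hfatou
    _ ≤ liminf (fun _ : ℕ => C) atTop := liminf_le_liminf (Eventually.of_forall hC)
    _ = C := liminf_const C

/-- The inequality in the Sobolev space `H¹`. -/
theorem lintegral_gammaBeta_le_of_hasWeakGrad {d : ℕ} (hd : 2 ≤ d) {β : ℝ → ℝ} {k : Sph d}
    (hβ : IsCollisionKernel β k) {g : Sph d → ℝ} {G : Sph d → Euc d} (hg : HasWeakGrad g G)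
    (heven : ∀ᵐ σ ∂(surf d), g (-σ) = g σ) :
    ∫⁻ x, gammaBeta β g x ∂(surf d) ≤
      ENNReal.ofReal (sigmaBeta β k) * ∫⁻ x, ENNReal.ofReal (‖G x‖ ^ 2) ∂(surf d) := by
  have hgi : Integrable g (surf d) := hg.memLp.integrable one_le_two
  have hF := fun n => contDiff_zonalConv (zonalPeak k n) hgi
  have hcont : ∀ n, Continuous fun x : Sph d => zonalConv (zonalPeak k n) g x := fun n =>
    (hF n).continuous.comp continuous_subtype_val
  -- Convergence in `L¹` gives convergence in measure, hence almost everywhere along a subsequence,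
  -- to which Fatou's lemma applies.
  have htend : TendstoInMeasure (surf d) (fun n (x : Sph d) => zonalConv (zonalPeak k n) g x)
      atTop g := by
    refine tendstoInMeasure_of_tendsto_eLpNorm one_ne_zero
      (fun n => (hcont n).aestronglyMeasurable) hgi.aestronglyMeasurable ?_
    simp only [eLpNorm_one_eq_lintegral_enorm]
    exact tendsto_lintegral_enorm_zonalConv_sub k hgi
  obtain ⟨ns, -, hns⟩ := htend.exists_seq_tendsto_ae
  refine lintegral_gammaBeta_le_of_tendsto hβ.measurable (fun n => hcont (ns n)) hns fun n => ?_
  refine (lintegral_gammaBeta_le hd hβ (sphContDiff_of_contDiff (by exact_mod_cast hF (ns n))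
    fun σ => rfl) fun σ => zonalConv_neg _ hgi heven _).trans ?_
  exact mul_le_mul_right (lintegral_norm_sphGrad_zonalConv_sq_le (zonalPeak_nonneg k _)
    (integral_zonalPeak k _) hg) _

/-! ### The extremal function and the conclusion -/

/-- A function for which the inequality is an equality between finite, nonzero quantities. -/
theorem exists_sharp_function {d : ℕ} (hd : 2 ≤ d) {β : ℝ → ℝ} {k : Sph d}
    (hβ : IsCollisionKernel β k) : ∃ g : Sph d → ℝ, (∀ n : ℕ∞, SphContDiff n g) ∧
      HasWeakGrad g (sphGrad g) ∧ (∀ σ, g (-σ) = g σ) ∧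
      ∀ C : ℝ≥0∞, ∫⁻ x, gammaBeta β g x ∂(surf d) ≤
        C * ∫⁻ x, ENNReal.ofReal (‖sphGrad g x‖ ^ 2) ∂(surf d) →
          ENNReal.ofReal (sigmaBeta β k) ≤ C := by
  obtain ⟨p, q, hp, hq, hpq⟩ := exists_orthonormal_pair hd
  set g : Sph d → ℝ := fun σ => ⟪p, (σ : Euc d)⟫ * ⟪q, (σ : Euc d)⟫ with hg
  have hF : ∀ n : WithTop ℕ∞, ContDiff ℝ n fun x : Euc d => ⟪p, x⟫ * ⟪q, x⟫ := fun n =>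
    (innerSL ℝ p).contDiff.mul (innerSL ℝ q).contDiff
  have hgs : ∀ n : ℕ∞, SphContDiff n g := fun n => sphContDiff_of_contDiff (hF n) fun σ => rfl
  refine ⟨g, hgs, hasWeakGrad_sphGrad (hF 1) fun σ => rfl, fun σ => ?_, fun C hC => ?_⟩
  · simp only [hg]
    rw [show ((-σ : Sph d) : Euc d) = -(σ : Euc d) from rfl, inner_neg_right, inner_neg_right,
      neg_mul_neg]
  · rw [lintegral_gammaBeta_inner_mul_inner hd hβ p q fun σ => rfl] at hC
    exact (ENNReal.mul_le_mul_iff_left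
      (lintegral_norm_sphGrad_inner_mul_inner_ne_zero hp hq hpq fun σ => rfl)
      (lintegral_norm_sphGrad_sq_ne_top (hgs 1))).1 hC

theorem mainTheorem9 (d : ℕ) (hd : 2 ≤ d) :
    -- the optimal inequality between `∫ Γ_β(g)` and `∫ |∇g|²` for even functions
    (∀ (β : ℝ → ℝ) (k : Sph d), IsCollisionKernel β k →
      -- in the Sobolev space `H¹`
      IsLeast {C : ℝ≥0∞ | ∀ (g : Sph d → ℝ) (G : Sph d → Euc d), HasWeakGrad g G →
          (∀ᵐ σ ∂(surf d), g (-σ) = g σ) →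
          ∫⁻ x, gammaBeta β g x ∂(surf d) ≤ C * ∫⁻ x, ENNReal.ofReal (‖G x‖ ^ 2) ∂(surf d)}
        (ENNReal.ofReal (sigmaBeta β k)) ∧
      -- among functions of class `Cⁿ`, for each `1 ≤ n ≤ ∞`
      ∀ n : ℕ∞, 1 ≤ n →
        IsLeast {C : ℝ≥0∞ | ∀ g : Sph d → ℝ, SphContDiff n g → (∀ σ, g (-σ) = g σ) →
            ∫⁻ x, gammaBeta β g x ∂(surf d)
              ≤ C * ∫⁻ x, ENNReal.ofReal (‖sphGrad g x‖ ^ 2) ∂(surf d)}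
          (ENNReal.ofReal (sigmaBeta β k))) ∧
    -- the inequality for Legendre polynomials of even order, with its equality cases
    (∀ ℓ : ℕ, Even ℓ →
      (∀ x ∈ Ioo (-1 : ℝ) 1,
        (1 - (legendreP d ℓ).eval x) / (1 - x ^ 2)
          ≤ (ℓ : ℝ) * (ℓ + d - 2) / (2 * ((d : ℝ) - 1))) ∧
      (ℓ = 2 → ∀ x ∈ Ioo (-1 : ℝ) 1,
        (1 - (legendreP d ℓ).eval x) / (1 - x ^ 2)
          = (ℓ : ℝ) * (ℓ + d - 2) / (2 * ((d : ℝ) - 1))) ∧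
      Tendsto (fun x : ℝ => (1 - (legendreP d ℓ).eval x) / (1 - x ^ 2)) (𝓝[<] 1)
        (𝓝 ((ℓ : ℝ) * (ℓ + d - 2) / (2 * ((d : ℝ) - 1)))) ∧
      Tendsto (fun x : ℝ => (1 - (legendreP d ℓ).eval x) / (1 - x ^ 2)) (𝓝[>] (-1))
        (𝓝 ((ℓ : ℝ) * (ℓ + d - 2) / (2 * ((d : ℝ) - 1))))) := by
  refine ⟨fun β k hβ => ?_, fun ℓ hℓ => ⟨fun x hx => one_sub_eval_legendreP_le hd hℓ hx, ?_,
    (tendsto_one_sub_eval_legendreP_one hd ℓ).mono_left (nhdsWithin_mono _ fun x hx => ?_),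
    tendsto_one_sub_eval_legendreP_neg_one hd hℓ⟩⟩
  · obtain ⟨g, hgs, hgw, heven, hsharp⟩ := exists_sharp_function hd hβ
    refine ⟨⟨fun u G hu hev => lintegral_gammaBeta_le_of_hasWeakGrad hd hβ hu hev, fun C hC => ?_⟩,
      fun n hn => ⟨fun u hu hev => lintegral_gammaBeta_le hd hβ (hu.of_le hn) hev, fun C hC => ?_⟩⟩
    · exact hsharp C (hC g (sphGrad g) hgw (Eventually.of_forall heven))
    · exact hsharp C (hC g (hgs n) heven)
  · rintro rfl x hx
    exact one_sub_eval_legendreP_two hd hx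
  · exact ne_of_lt hx
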